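/- **Setting.** $G(m,Q)$ is the Gaussian law with mean $m$ and (possibly singular) variance matrix $Q$; $F^X$ is the $\sigma$-algebra generated by $X$; $Q_{X,W}$ is the cross-covariance matrix of $X$ and $W$, $Q_W=Q_{W,W}$; $I(\cdot;\cdot)$ is mutual information in nats, with values in $[0,\infty]$. For random vectors $Y_1,Y_2$, $$C(Y_1,Y_2)=\inf I(Y_1,Y_2;W),$$ where the infimum is over all jointly Gaussian laws of triples $(Y_1,Y_2,W)$ with the given $(Y_1,Y_2)$-marginal, with $W$ of arbitrary finite dimension, such that $Y_1,Y_2$ are conditionally independent given $W$. Let $n_1,n_2,p_{13},p_{23}\in\mathbb N$ (a component of dimension $0$ is absent), and let $Y_1=(Y_{11},Y_{12},Y_{13})$, $Y_2=(Y_{21},Y_{22},Y_{23})$ be random vectors with blocks of dimensions $(n_1,n_2,p_{13})$ and $(n_1,n_2,p_{23})$ in canonical variable form, that is, $$(Y_1,Y_2)\in G(0,Q_{\rm cvf}),\quad Q_{\rm cvf}=\begin{pmatrix} I & K\\ K^T& I\end{pmatrix},\quad K=\begin{pmatrix} I_{n_1}&0&0\\0&D&0\\0&0&0\end{pmatrix},\quad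 D={\rm Diag}(d_1,\dots,d_{n_2}),\ 1>d_1\ge\dots\ge d_{n_2}>0 .$$ **(a)** $C(Y_1,Y_2)=C(Y_{11},Y_{21})+C(Y_{12},Y_{22})+C(Y_{13},Y_{23})$, and $$C(Y_1,Y_2)=\begin{cases}0,& n_1=n_2=0,\\ \frac12\sum_{i=1}^{n_2}\ln\frac{1+d_i}{1-d_i},& n_1=0,\\ +\infty,& n_1>0.\end{cases}$$ Moreover $C(Y_{11},Y_{21})=+\infty$ if $n_1>0$, $C(Y_{13},Y_{23})=0$, and $C(Y_{12},Y_{22})=\frac12\sum_{i=1}^{n_2}\ln\frac{1+d_i}{1-d_i}$. The four quantities $C$ do not change if arbitrary, not necessarily Gaussian, $W$ are admitted in the infimum. If $Y_i=S_iX_i$ with nonsingular matrices $S_i$, $i=1,2$, then $C(X_1,X_2)=C(Y_1,Y_2)$, for both versions of the infimum. The infimum $C(Y_1,Y_2)$ is attained by some $W$ of dimension $n_1+n_2$. **(b)** Let $V\in G(0,I_{n_2})$ be independent of $(Y_1,Y_2)$ and put $$W^*=(W_1^*,W_2^*),\quad W_1^*=Y_{11},\quad W_2^*=L_1Y_{12}+L_2Y_{22}+L_3V,$$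 $$L_1=L_2=D^{1/2}(I+D)^{-1},\qquad L_3=(I-D)^{1/2}(I+D)^{-1/2}.$$ Then $W_1^*=Y_{21}$ a.s.; $(Y_1,Y_2,W^*)$ is jointly Gaussian with mean zero, $Q_{(Y_1,Y_2)}=Q_{\rm cvf}$, $Q_{W^*}=I$ and $$Q_{Y_1,W^*}=\begin{pmatrix} I&0\\0&D^{1/2}\\0&0\end{pmatrix},\quad Q_{Y_2,W^*}=\begin{pmatrix} I&0\\0&D^{1/2}\\0&0\end{pmatrix};\qquad (Y_{12},Y_{22},W_2^*)\in G(0,Q_s(I)),\quad Q_s(I)=\begin{pmatrix} I&D&D^{1/2}\\D&I&D^{1/2}\\D^{1/2}&D^{1/2}&I\end{pmatrix};$$ $Y_1$ and $Y_2$ are conditionally independent given $W^*$; $F^{W_1^*}\subseteq F^{Y_{11}}\vee F^{Y_{21}}$ and $F^{W_2^*}\subseteq F^{Y_{12}}\vee F^{Y_{22}}\vee F^{V}$; and $C(Y_1,Y_2)=I(Y_1,Y_2;W^*)$. **(c)** For $i=1,2$ put $Z_i=(Z_{i2},Z_{i3})$ with $Z_{i2}=Y_{i2}-\mathbf E[Y_{i2}\mid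 F^{W_2^*}]$ and $Z_{i3}=Y_{i3}$. Then $Q_{W_2^*}=I$, $\mathbf E[Y_{i2}\mid F^{W_2^*}]=Q_{Y_{i2},W_2^*}Q_{W_2^*}^{-1}W_2^*$ a.s., $Q_{Y_{i2},W_2^*}Q_{W_2^*}^{-1}=D^{1/2}$, and almost surely $$\begin{pmatrix}Y_{i1}\\Y_{i2}\\Y_{i3}\end{pmatrix}=\begin{pmatrix} I&0\\0&Q_{Y_{i2},W_2^*}Q_{W_2^*}^{-1}\\0&0\end{pmatrix}\begin{pmatrix}W_1^*\\W_2^*\end{pmatrix}+\begin{pmatrix}0&0\\I&0\\0&I\end{pmatrix}\begin{pmatrix}Z_{i2}\\Z_{i3}\end{pmatrix},\qquad i=1,2,$$ where $Z_1,Z_2,W^*$ are independent, $W^*\in G(0,I)$ and $Z_i\in G\left(0,\begin{pmatrix}I-D&0\\0&I\end{pmatrix}\right)$. -/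

import Mathlib

open MeasureTheory ProbabilityTheory
open scoped ENNReal Matrix

noncomputable section

/-- Column vectors with real entries indexed by `ι`, with the Borel `σ`-algebra. -/
abbrev Vec (ι : Type) [Fintype ι] : Type := EuclideanSpace ℝ ι

/-- The index type of a vector made of an identical, a correlated and a private part, of
dimensions `n₁`, `n₂` and `k`. -/
abbrev Idx (n₁ n₂ k : ℕ) : Type := Fin n₁ ⊕ (Fin n₂ ⊕ Fin k)

section Blocks

variable {ι κ : Type} [Fintype ι] [Fintype κ]

/-- Stacking of two column vectors. -/
def vcat (x : Vec ι) (y : Vec κ) : Vec (ι ⊕ κ) := WithLp.toLp 2 (Sum.elim (fun i => x i) fun j => y j)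

/-- Product of a matrix and a column vector. -/
def mulV (A : Matrix ι κ ℝ) (x : Vec κ) : Vec ι := WithLp.toLp 2 (A *ᵥ fun j => x j)

variable {n₁ n₂ k : ℕ}

/-- First block (the identical part) of a vector. -/
def part1 (y : Vec (Idx n₁ n₂ k)) : Vec (Fin n₁) := WithLp.toLp 2 fun i => y (Sum.inl i)

/-- Second block (the correlated part) of a vector. -/
def part2 (y : Vec (Idx n₁ n₂ k)) : Vec (Fin n₂) := WithLp.toLp 2 fun i => y (Sum.inr (Sum.inl i))

/-- Third block (the private part) of a vector. -/
def part3 (y : Vec (Idx n₁ n₂ k)) : Vec (Fin k) := WithLp.toLp 2 fun i => y (Sum.inr (Sum.inr i))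

end Blocks

section Gaussian

variable {Ω : Type*} [MeasurableSpace Ω] {ι κ : Type} [Fintype ι] [Fintype κ]

/-- `X ∈ G(0, Q)`: the random vector `X` is Gaussian with mean zero and (possibly singular)
variance matrix `Q`. -/
def IsG0 [DecidableEq ι] (X : Ω → Vec ι) (Q : Matrix ι ι ℝ) (μ : Measure Ω) : Prop :=
  Q.PosSemidef ∧ HasLaw X (multivariateGaussian 0 Q) μ

/-- The cross-covariance matrix `Q_{X,W}` of two random vectors (`Q_W` if `X = W`). -/
def crossCov (X : Ω → Vec ι) (W : Ω → Vec κ) (μ : Measure Ω) : Matrix ι κ ℝ :=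
  Matrix.of fun i j => cov[fun ω => X ω i, fun ω => W ω j; μ]

/-- The matrix `Q_{X,W} Q_W⁻¹`. -/
def regMatrix [DecidableEq κ] (X : Ω → Vec ι) (W : Ω → Vec κ) (μ : Measure Ω) : Matrix ι κ ℝ :=
  crossCov X W μ * (crossCov W W μ)⁻¹

end Gaussian

section Information

/-- `(m₁, m₂ | m') ∈ CI`: conditional independence of the `σ`-algebras `m₁`, `m₂` given `m'`, on an
arbitrary probability space. (On a standard Borel space, for sub-`σ`-algebras, this is Mathlib's
`ProbabilityTheory.CondIndep`, by `ProbabilityTheory.condIndep_iff`.) -/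
def IsCI {Ω : Type*} (m₁ m₂ m' : MeasurableSpace Ω) [MeasurableSpace Ω] (μ : Measure Ω) : Prop :=
  ∀ s t : Set Ω, MeasurableSet[m₁] s → MeasurableSet[m₂] t →
    μ[(s ∩ t).indicator (fun _ => (1 : ℝ)) | m'] =ᵐ[μ]
      μ[s.indicator (fun _ => (1 : ℝ)) | m'] * μ[t.indicator (fun _ => (1 : ℝ)) | m']

/-- The `σ`-algebra `F^X` generated by a random variable. -/
abbrev sigmaOf {Ω α : Type*} [mα : MeasurableSpace α] (X : Ω → α) : MeasurableSpace Ω :=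
  mα.comap X

/-- Conditional independence of two random variables given a third one. -/
def IsCIFun {Ω α β γ : Type*} [MeasurableSpace Ω] [MeasurableSpace α] [MeasurableSpace β]
    [MeasurableSpace γ] (Y₁ : Ω → α) (Y₂ : Ω → β) (W : Ω → γ) (μ : Measure Ω) : Prop :=
  IsCI (sigmaOf Y₁) (sigmaOf Y₂) (sigmaOf W) μ

/-- `(Y₁, Y₂ | W) ∈ CIG`: `(Y₁, Y₂, W)` is jointly Gaussian and `Y₁`, `Y₂` are conditionally
independent given `W`. -/
def IsCIG {Ω : Type*} [MeasurableSpace Ω] {ι κ τ : Type} [Fintype ι] [Fintype κ] [Fintype τ]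
    (Y₁ : Ω → Vec ι) (Y₂ : Ω → Vec κ) (W : Ω → Vec τ) (μ : Measure Ω) : Prop :=
  HasGaussianLaw (fun ω => ((Y₁ ω, Y₂ ω), W ω)) μ ∧ IsCIFun Y₁ Y₂ W μ

/-- Mutual information `I(X; Z)` in nats: the relative entropy of the joint law with respect to
the product of the marginal laws. -/
def mutualInfo {Ω α β : Type*} [MeasurableSpace Ω] [MeasurableSpace α] [MeasurableSpace β]
    (X : Ω → α) (Z : Ω → β) (μ : Measure Ω) : ℝ≥0∞ :=
  InformationTheory.klDiv (μ.map fun ω => (X ω, Z ω)) ((μ.map X).prod (μ.map Z))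

variable {ι κ : Type} [Fintype ι] [Fintype κ]

/-- The set `𝒫^{CIG}` (for `W` with index set `τ`): the laws of jointly Gaussian triples
`(Y₁, Y₂, W)` with `(Y₁, Y₂)`-marginal `P` and with `Y₁`, `Y₂` conditionally independent
given `W`. -/
def cigLaws (P : Measure (Vec ι × Vec κ)) (τ : Type) [Fintype τ] :
    Set (Measure ((Vec ι × Vec κ) × Vec τ)) :=
  {Q | Q.fst = P ∧ IsCIG (fun z => z.1.1) (fun z => z.1.2) (fun z => z.2) Q}

/-- Wyner's common information of a pair with law `P`: the infimum of `I(Y₁, Y₂; W)` over all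
jointly Gaussian triples in which `(Y₁, Y₂)` has law `P` and the finite-dimensional vector `W`
makes `Y₁`, `Y₂` conditionally independent. -/
def commonInfo (P : Measure (Vec ι × Vec κ)) : ℝ≥0∞ :=
  ⨅ (k : ℕ) (Q ∈ cigLaws P (Fin k)), mutualInfo (fun z => z.1) (fun z => z.2) Q

/-- The same infimum over arbitrary (not necessarily Gaussian or finite-dimensional) `W`. -/
def commonInfoArb (P : Measure (Vec ι × Vec κ)) : ℝ≥0∞ :=
  ⨅ (𝕎 : Type) (_ : MeasurableSpace 𝕎) (Q : Measure ((Vec ι × Vec κ) × 𝕎)) (_ : Q.fst = P)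
    (_ : IsCIFun (fun z : (Vec ι × Vec κ) × 𝕎 => z.1.1) (fun z => z.1.2) (fun z => z.2) Q),
    mutualInfo (fun z => z.1) (fun z => z.2) Q

/-- `C(Y₁, Y₂)` for random vectors on a probability space. -/
def wynerCI {Ω : Type*} [MeasurableSpace Ω] (Y₁ : Ω → Vec ι) (Y₂ : Ω → Vec κ)
    (μ : Measure Ω) : ℝ≥0∞ :=
  commonInfo (μ.map fun ω => (Y₁ ω, Y₂ ω))

/-- `C(Y₁, Y₂)` with the infimum over arbitrary `W`. -/
def wynerCIArb {Ω : Type*} [MeasurableSpace Ω] (Y₁ : Ω → Vec ι) (Y₂ : Ω → Vec κ)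
    (μ : Measure Ω) : ℝ≥0∞ :=
  commonInfoArb (μ.map fun ω => (Y₁ ω, Y₂ ω))

end Information

section Canonical

variable {n₁ n₂ k₁ k₂ : ℕ}

/-- The cross-covariance block of the canonical variable form, `Block-diag(I, D, 0)`. -/
def cvfCross (n₁ k₁ k₂ : ℕ) (d : Fin n₂ → ℝ) : Matrix (Idx n₁ n₂ k₁) (Idx n₁ n₂ k₂) ℝ :=
  Matrix.fromBlocks 1 0 0 (Matrix.fromBlocks (Matrix.diagonal d) 0 0 0)

/-- The variance matrix `Q_cvf` of the canonical variable form. -/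
def qCvf (n₁ k₁ k₂ : ℕ) (d : Fin n₂ → ℝ) :
    Matrix (Idx n₁ n₂ k₁ ⊕ Idx n₁ n₂ k₂) (Idx n₁ n₂ k₁ ⊕ Idx n₁ n₂ k₂) ℝ :=
  Matrix.fromBlocks 1 (cvfCross n₁ k₁ k₂ d) (cvfCross n₁ k₁ k₂ d)ᵀ 1

/-- The pair `(Y₁, Y₂)` of random vectors is in canonical variable form, with canonical
correlation coefficients `1 > d₁ ≥ … ≥ d_{n₂} > 0`. -/
structure IsCanonical {Ω : Type*} [MeasurableSpace Ω] (d : Fin n₂ → ℝ)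
    (Y₁ : Ω → Vec (Idx n₁ n₂ k₁)) (Y₂ : Ω → Vec (Idx n₁ n₂ k₂)) (μ : Measure Ω) : Prop where
  measurable_left : Measurable Y₁
  measurable_right : Measurable Y₂
  pos : ∀ i, 0 < d i
  lt_one : ∀ i, d i < 1
  antitone : Antitone d
  law : IsG0 (fun ω => vcat (Y₁ ω) (Y₂ ω)) (qCvf n₁ k₁ k₂ d) μ

/-- `D^{1/2}`. -/
def sqrtD (d : Fin n₂ → ℝ) : Matrix (Fin n₂) (Fin n₂) ℝ := Matrix.diagonal fun i => √(d i)

/-- `L₁ = L₂ = D^{1/2} (I + D)⁻¹`. -/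
def matL (d : Fin n₂ → ℝ) : Matrix (Fin n₂) (Fin n₂) ℝ :=
  Matrix.diagonal fun i => √(d i) / (1 + d i)

/-- `L₃ = (I - D)^{1/2} (I + D)^{-1/2}`. -/
def matL3 (d : Fin n₂ → ℝ) : Matrix (Fin n₂) (Fin n₂) ℝ :=
  Matrix.diagonal fun i => √(1 - d i) / √(1 + d i)

/-- The variance matrix `Q_s(Q_W)`. -/
def qS (d : Fin n₂ → ℝ) (QW : Matrix (Fin n₂) (Fin n₂) ℝ) :
    Matrix ((Fin n₂ ⊕ Fin n₂) ⊕ Fin n₂) ((Fin n₂ ⊕ Fin n₂) ⊕ Fin n₂) ℝ :=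
  Matrix.fromBlocks (Matrix.fromBlocks 1 (Matrix.diagonal d) (Matrix.diagonal d) 1)
    (Matrix.fromRows (sqrtD d) (sqrtD d * QW))
    (Matrix.fromCols (sqrtD d) (QW * sqrtD d)) QW

/-- The matrix with block rows `(I, 0)`, `(0, M)`, `(0, 0)`. -/
def loadW (n₁ k : ℕ) (M : Matrix (Fin n₂) (Fin n₂) ℝ) :
    Matrix (Idx n₁ n₂ k) (Fin n₁ ⊕ Fin n₂) ℝ :=
  Matrix.fromBlocks 1 0 0 (Matrix.fromRows M 0)

/-- The matrix with block rows `(0, 0)`, `(I, 0)`, `(0, I)`. -/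
def loadZ (n₁ n₂ k : ℕ) : Matrix (Idx n₁ n₂ k) (Fin n₂ ⊕ Fin k) ℝ :=
  Matrix.fromRows 0 1

/-- `Q_s(I)` for the complete vectors: the variance matrix of `(Y₁, Y₂, W*)`, with
`Q_{W*} = I` and `Q_{Y_j,W*}` having the block rows `(I, 0)`, `(0, D^{1/2})`, `(0, 0)`. -/
def qTriple (n₁ k₁ k₂ : ℕ) (d : Fin n₂ → ℝ) :
    Matrix ((Idx n₁ n₂ k₁ ⊕ Idx n₁ n₂ k₂) ⊕ (Fin n₁ ⊕ Fin n₂))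
      ((Idx n₁ n₂ k₁ ⊕ Idx n₁ n₂ k₂) ⊕ (Fin n₁ ⊕ Fin n₂)) ℝ :=
  Matrix.fromBlocks (qCvf n₁ k₁ k₂ d)
    (Matrix.fromRows (loadW n₁ k₁ (sqrtD d)) (loadW n₁ k₂ (sqrtD d)))
    (Matrix.fromRows (loadW n₁ k₁ (sqrtD d)) (loadW n₁ k₂ (sqrtD d)))ᵀ 1

variable {Ω : Type*}

/-- `W₁* = Y₁₁`. -/
def wStar1 (Y₁ : Ω → Vec (Idx n₁ n₂ k₁)) : Ω → Vec (Fin n₁) := fun ω => part1 (Y₁ ω)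

/-- `W₂* = L₁ Y₁₂ + L₂ Y₂₂ + L₃ V`. -/
def wStar2 (d : Fin n₂ → ℝ) (Y₁ : Ω → Vec (Idx n₁ n₂ k₁)) (Y₂ : Ω → Vec (Idx n₁ n₂ k₂))
    (V : Ω → Vec (Fin n₂)) : Ω → Vec (Fin n₂) := fun ω =>
  mulV (matL d) (part2 (Y₁ ω)) + mulV (matL d) (part2 (Y₂ ω)) + mulV (matL3 d) (V ω)

/-- `W* = (W₁*, W₂*)`. -/
def wStar (d : Fin n₂ → ℝ) (Y₁ : Ω → Vec (Idx n₁ n₂ k₁)) (Y₂ : Ω → Vec (Idx n₁ n₂ k₂))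
    (V : Ω → Vec (Fin n₂)) : Ω → Vec (Fin n₁ ⊕ Fin n₂) := fun ω =>
  vcat (wStar1 Y₁ ω) (wStar2 d Y₁ Y₂ V ω)

/-- `Z = (Y_{·2} - E[Y_{·2} | F^W], Y_{·3})` for a random vector `Y` with blocks `Y_{·1}`,
`Y_{·2}`, `Y_{·3}`. -/
def noise [MeasurableSpace Ω] {k : ℕ} (Y : Ω → Vec (Idx n₁ n₂ k)) (W : Ω → Vec (Fin n₂))
    (μ : Measure Ω) : Ω → Vec (Fin n₂ ⊕ Fin k) := fun ω =>
  vcat (part2 (Y ω) - μ[fun ω' => part2 (Y ω') | sigmaOf W] ω) (part3 (Y ω))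

/-- The variance matrix `Block-diag(I - D, I)`. -/
def qNoise (k : ℕ) (d : Fin n₂ → ℝ) : Matrix (Fin n₂ ⊕ Fin k) (Fin n₂ ⊕ Fin k) ℝ :=
  Matrix.fromBlocks (1 - Matrix.diagonal d) 0 0 1

end Canonical

end

/-!
Wyner's common information of a Gaussian pair `(Y₁, Y₂)` in canonical variable form. Three facts
give the value `½ ∑ log ((1 + d i) / (1 - d i))`, respectively `⊤` if there is an identical part.

*Lower bound for an arbitrary `W`.* If `f` and `g` are functions of `Y₁` and of `Y₂`, then
conditional independence given `W` makes the residuals `f - E[f | W]` and `g - E[g | W]`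
uncorrelated. Hence `f + g` and `f - g` have the same mean conditional variance, and
`E Var(f + g | W) ≤ E (f - g)²` (`IsCI.integral_sq_residual_add_le`). For a pair of canonical
components with correlation `d` the right-hand side is `2 (1 - d)`, so that the normalized sum
`(Y₁ᵢ + Y₂ᵢ) / √(2 (1 + d))`, a standard Gaussian variable, is estimated from `W` with mean square
error at most `(1 - d) / (1 + d)`. The Donsker–Varadhan inequality (`ofReal_integral_le_klDiv`),
applied to the log-density of the Gaussian law centred at the estimates, converts these errors into
a lower bound for the mutual information (`ofReal_sum_log_le_mutualInfo`,
`IsCIFun.ofReal_sum_log_le_mutualInfo`). In the identical part `d = 1`, the error is zero, and the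
mutual information is infinite (`IsCanonical.mutualInfo_eq_top`). Neither Gaussianity nor finite
dimension of `W` is used, hence both versions of the infimum obey the bound.

*Attainment.* The joint law of `(Y₁, Y₂, W*)` is that of a linear image of the Gaussian vector
`(Y₁, Y₂, V)` (`IsG0.of_linear`, `IsCanonical.isG0_triple`). The same argument shows that the noises
`Y_{·2} - D^{1/2} W₂*`, `Y_{·3}` of the two vectors and `W*` are independent
(`IsCanonical.isG0_noise_triple`). So `Y₁` and `Y₂` are functions of `W*` and of independent noises,
hence conditionally independent given `W*` (`isCIFun_of_indepFun`). Without an identical part,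
`W* = c (Y₁, Y₂) + L₃ V` is the output of an additive Gaussian channel with standard Gaussian
output, whose mutual information is `-∑ log L₃` (`mutualInfo_gaussianChannel`); this is the lower
bound, because `L₃² = (1 - d) / (1 + d)` (`IsCanonical.mutualInfo_wStar`).

*Conclusion.* Thus `value ≤ wynerCIArb ≤ wynerCI ≤ I(Y₁, Y₂; W*) = value`, where `V` is supplied by
a product space (`IsCanonical.exists_wynerCI_eq`). By data processing, both versions of the infimum
are invariant under linear isomorphisms (`wynerCI_comp_equiv`). In particular, the blocks of
`(Y₁, Y₂)` are, after a re-enumeration of the components, pairs in canonical variable form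
themselves, and the same value formula applies to them (`IsCanonical.wynerCI_subvector`).
-/

/-! ### Mutual information and conditional independence under changes of variables -/

section ChangeOfVariables

variable {Ω Ω' α β γ α' β' : Type*} [MeasurableSpace Ω] [MeasurableSpace Ω'] [MeasurableSpace α]
  [MeasurableSpace β] [MeasurableSpace γ] [MeasurableSpace α'] [MeasurableSpace β']

lemma mutualInfo_map {μ : Measure Ω} {T : Ω → Ω'} (hT : Measurable T) {X : Ω' → α} {Z : Ω' → β}
    (hX : Measurable X) (hZ : Measurable Z) :
    mutualInfo X Z (μ.map T) = mutualInfo (fun ω => X (T ω)) (fun ω => Z (T ω)) μ := by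
  unfold mutualInfo
  rw [Measure.map_map (hX.prodMk hZ) hT, Measure.map_map hX hT, Measure.map_map hZ hT]
  rfl

/-- Data processing: mutual information does not grow under deterministic maps. -/
lemma mutualInfo_comp_le {μ : Measure Ω} [IsProbabilityMeasure μ] {X : Ω → α} {Z : Ω → β}
    (hX : Measurable X) (hZ : Measurable Z) {f : α → α'} {g : β → β'} (hf : Measurable f)
    (hg : Measurable g) :
    mutualInfo (fun ω => f (X ω)) (fun ω => g (Z ω)) μ ≤ mutualInfo X Z μ := by
  have := Measure.isProbabilityMeasure_map (μ := μ) hX.aemeasurable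
  have := Measure.isProbabilityMeasure_map (μ := μ) hZ.aemeasurable
  have := Measure.isProbabilityMeasure_map (μ := μ) (hX.prodMk hZ).aemeasurable
  have h := InformationTheory.klDiv_map_le (μ.map fun ω => (X ω, Z ω))
    ((μ.map X).prod (μ.map Z)) (hf.prodMap hg)
  rw [Measure.map_map (hf.prodMap hg) (hX.prodMk hZ), ← Measure.map_prod_map _ _ hf hg,
    Measure.map_map hf hX, Measure.map_map hg hZ] at h
  exact h

lemma condExp_map_comp {Ω Ω' : Type*} {mΩ : MeasurableSpace Ω} {m mΩ' : MeasurableSpace Ω'}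
    {μ : Measure Ω} [IsFiniteMeasure μ] {T : Ω → Ω'} (hT : Measurable T) (hm : m ≤ mΩ')
    {f : Ω' → ℝ} (hf : Integrable f (μ.map T)) :
    (fun ω => ((μ.map T)[f | m]) (T ω)) =ᵐ[μ] μ[fun ω => f (T ω) | m.comap T] := by
  have hle : m.comap T ≤ mΩ := (MeasurableSpace.comap_mono hm).trans hT.comap_le
  have hc : StronglyMeasurable[m] ((μ.map T)[f | m]) := stronglyMeasurable_condExp
  refine ae_eq_condExp_of_forall_setIntegral_eq hle (hf.comp_measurable hT)
    (fun s _ _ => (integrable_condExp.comp_measurable hT).integrableOn) ?_ ?_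
  · rintro _ ⟨t, ht, rfl⟩ -
    rw [← setIntegral_map (hm t ht) (hc.mono hm).aestronglyMeasurable hT.aemeasurable,
      ← setIntegral_map (hm t ht) hf.aestronglyMeasurable hT.aemeasurable,
      setIntegral_condExp hm hf ht]
  · exact (hc.comp_measurable (comap_measurable T)).aestronglyMeasurable

/-- Conditional independence is a property of the joint law. -/
lemma isCIFun_map_iff {μ : Measure Ω} [IsFiniteMeasure μ] {T : Ω → Ω'} (hT : Measurable T)
    {Y₁ : Ω' → α} {Y₂ : Ω' → β} {W : Ω' → γ} (h₁ : Measurable Y₁) (h₂ : Measurable Y₂)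
    (hW : Measurable W) :
    IsCIFun Y₁ Y₂ W (μ.map T) ↔
      IsCIFun (fun ω => Y₁ (T ω)) (fun ω => Y₂ (T ω)) (fun ω => W (T ω)) μ := by
  have key : ∀ s t : Set Ω', MeasurableSet s → MeasurableSet t →
      (((μ.map T)[(s ∩ t).indicator (fun _ => (1 : ℝ)) | sigmaOf W] =ᵐ[μ.map T]
        (μ.map T)[s.indicator (fun _ => (1 : ℝ)) | sigmaOf W] *
          (μ.map T)[t.indicator (fun _ => (1 : ℝ)) | sigmaOf W]) ↔
      (μ[(T ⁻¹' s ∩ T ⁻¹' t).indicator (fun _ => (1 : ℝ)) | sigmaOf fun ω => W (T ω)] =ᵐ[μ]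
        μ[(T ⁻¹' s).indicator (fun _ => (1 : ℝ)) | sigmaOf fun ω => W (T ω)] *
          μ[(T ⁻¹' t).indicator (fun _ => (1 : ℝ)) | sigmaOf fun ω => W (T ω)])) := by
    intro s t hs ht
    have e : ∀ u : Set Ω', MeasurableSet u →
        (fun ω => ((μ.map T)[u.indicator (fun _ => (1 : ℝ)) | sigmaOf W]) (T ω)) =ᵐ[μ]
          μ[(T ⁻¹' u).indicator (fun _ => (1 : ℝ)) | sigmaOf fun ω => W (T ω)] := by
      intro u hu
      have h := condExp_map_comp (μ := μ) hT hW.comap_le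
        ((integrable_const (μ := μ.map T) (1 : ℝ)).indicator hu)
      rw [MeasurableSpace.comap_comp] at h
      exact h
    have hm : ∀ u : Set Ω',
        Measurable ((μ.map T)[u.indicator (fun _ => (1 : ℝ)) | sigmaOf W]) := fun u =>
      (stronglyMeasurable_condExp.mono hW.comap_le).measurable
    rw [← Set.preimage_inter]
    change (∀ᵐ z ∂(μ.map T), _ = _) ↔ _
    rw [ae_map_iff hT.aemeasurable (measurableSet_eq_fun (hm _) ((hm _).mul (hm _)))]
    constructor
    · intro h
      filter_upwards [h, e _ (hs.inter ht), e _ hs, e _ ht] with ω h h1 h2 h3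
      simp only [Pi.mul_apply] at h ⊢
      rw [← h1, ← h2, ← h3, h]
    · intro h
      filter_upwards [h, e _ (hs.inter ht), e _ hs, e _ ht] with ω h h1 h2 h3
      simp only [Pi.mul_apply] at h ⊢
      rw [h1, h2, h3, h]
  constructor
  · rintro h _ _ ⟨A, hA, rfl⟩ ⟨B, hB, rfl⟩
    exact (key _ _ (h₁ hA) (h₂ hB)).1 (h _ _ ⟨A, hA, rfl⟩ ⟨B, hB, rfl⟩)
  · rintro h _ _ ⟨A, hA, rfl⟩ ⟨B, hB, rfl⟩
    exact (key _ _ (h₁ hA) (h₂ hB)).2 (h _ _ ⟨A, hA, rfl⟩ ⟨B, hB, rfl⟩)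

end ChangeOfVariables

/-! ### A variational lower bound for the relative entropy -/

/-- The Donsker–Varadhan bound, for a test function normalized by `∫ exp g dν ≤ 1`. -/
lemma ofReal_integral_le_klDiv {α : Type*} [MeasurableSpace α] {μ ν : Measure α}
    [IsProbabilityMeasure μ] [IsProbabilityMeasure ν] {g : α → ℝ} (hg : Measurable g)
    (hgμ : Integrable g μ) (hgν : ∫⁻ x, ENNReal.ofReal (Real.exp (g x)) ∂ν ≤ 1) :
    ENNReal.ofReal (∫ x, g x ∂μ) ≤ InformationTheory.klDiv μ ν := by
  by_cases htop : InformationTheory.klDiv μ ν = ∞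
  · simp [htop]
  obtain ⟨hac, hint⟩ := InformationTheory.klDiv_ne_top_iff.1 htop
  have hexp : Integrable (fun x => Real.exp (g x)) ν := by
    refine ⟨hg.exp.aestronglyMeasurable, ?_⟩
    rw [hasFiniteIntegral_iff_ofReal (.of_forall fun _ => (Real.exp_pos _).le)]
    exact hgν.trans_lt ENNReal.one_lt_top
  have hle : ∫ x, Real.exp (g x) ∂ν ≤ 1 := by
    rw [integral_eq_lintegral_of_nonneg_ae (.of_forall fun _ => (Real.exp_pos _).le)
      hexp.aestronglyMeasurable]
    exact ENNReal.toReal_le_of_le_ofReal zero_le_one (by simpa using hgν)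
  have := isProbabilityMeasure_tilted hexp
  have h0 := InformationTheory.integral_llr_add_sub_measure_univ_nonneg
    (hac.trans (absolutelyContinuous_tilted hexp)) (integrable_llr_tilted_right hac hgμ hint hexp)
  rw [integral_llr_tilted_right hac hgμ hexp hint] at h0
  simp only [probReal_univ] at h0
  have hlog : Real.log (∫ x, Real.exp (g x) ∂ν) ≤ 0 :=
    Real.log_nonpos (integral_nonneg fun _ => (Real.exp_pos _).le) hle
  rw [← ENNReal.ofReal_toReal htop, InformationTheory.toReal_klDiv_of_measure_eq hac (by simp)]
  exact ENNReal.ofReal_le_ofReal (by linarith)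

/-! ### Conditionally independent variables have uncorrelated residuals -/

section Residuals

variable {Ω : Type*} {m m₁ m₂ m' mΩ : MeasurableSpace Ω} {μ : Measure Ω} [IsProbabilityMeasure μ]

/-- A function whose integral vanishes on the sets of `m` is orthogonal to all `m`-measurable
functions. -/
lemma integral_mul_eq_zero_of_setIntegral (hm : m ≤ mΩ) {f h : Ω → ℝ}
    (hh : Integrable h μ) (h0 : ∀ s, MeasurableSet[m] s → ∫ ω in s, h ω ∂μ = 0)
    (hf : StronglyMeasurable[m] f) (hfh : Integrable (f * h) μ) : ∫ ω, (f * h) ω ∂μ = 0 := by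
  have hz : (0 : Ω → ℝ) =ᵐ[μ] μ[h | m] :=
    ae_eq_condExp_of_forall_setIntegral_eq hm hh (fun _ _ _ => (integrable_zero _ _ _).integrableOn)
      (fun s hs _ => by simp [h0 s hs]) stronglyMeasurable_zero.aestronglyMeasurable
  rw [← integral_condExp hm, integral_congr_ae (condExp_mul_of_stronglyMeasurable_left hf hfh hh)]
  refine integral_eq_zero_of_ae ?_
  filter_upwards [hz] with ω hω
  simp [← hω]

lemma integral_mul_condExp (hm : m ≤ mΩ) {f g : Ω → ℝ}
    (hf : MemLp f 2 μ) (hg : MemLp g 2 μ) :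
    ∫ ω, f ω * (μ[g | m]) ω ∂μ = ∫ ω, (μ[f | m]) ω * (μ[g | m]) ω ∂μ := by
  have h := condExp_mul_of_stronglyMeasurable_right (μ := μ) (m := m) (f := f) (g := μ[g | m])
    stronglyMeasurable_condExp (hf.integrable_mul (hg.condExp one_le_two))
    (hf.integrable one_le_two)
  calc ∫ ω, f ω * (μ[g | m]) ω ∂μ = ∫ ω, (f * μ[g | m]) ω ∂μ := rfl
    _ = _ := by rw [← integral_condExp hm, integral_congr_ae h]; rfl

/-- Conditionally independent variables have uncorrelated residuals. For indicator functions this is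
the definition of conditional independence; the orthogonality extends to square-integrable functions
in one argument after the other. -/
lemma IsCI.integral_residual_mul_residual (h₁ : m₁ ≤ mΩ)
    (h₂ : m₂ ≤ mΩ) (h' : m' ≤ mΩ) (hCI : IsCI m₁ m₂ m' μ) {f g : Ω → ℝ}
    (hf : StronglyMeasurable[m₁] f) (hg : StronglyMeasurable[m₂] g) (hf2 : MemLp f 2 μ)
    (hg2 : MemLp g 2 μ) :
    ∫ ω, (f ω - (μ[f | m']) ω) * (g ω - (μ[g | m']) ω) ∂μ = 0 := by
  have hfc := hf2.condExp (m := m') one_le_two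
  have hgc := hg2.condExp (m := m') one_le_two
  have hI : ∀ s, MeasurableSet s → MemLp (s.indicator fun _ => (1 : ℝ)) 2 μ := fun s hs =>
    memLp_indicator_const 2 hs (1 : ℝ) (.inr (measure_ne_top _ _))
  have hIc : ∀ s, MeasurableSet s → MemLp (μ[s.indicator fun _ => (1 : ℝ) | m']) 2 μ :=
    fun s hs => (hI s hs).condExp one_le_two
  -- two indicator functions
  have hA : ∀ s t, MeasurableSet[m₁] s → MeasurableSet[m₂] t →
      ∫ ω in s, (t.indicator (fun _ => (1 : ℝ)) ω - (μ[t.indicator fun _ => (1 : ℝ) | m']) ω) ∂μ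
        = 0 := by
    intro s t hs ht
    have hs' := h₁ s hs
    have ht' := h₂ t ht
    rw [integral_sub ((hI t ht').integrable one_le_two).integrableOn
      integrable_condExp.integrableOn, sub_eq_zero, ← integral_indicator hs',
      ← integral_indicator hs']
    have e1 : s.indicator (t.indicator fun _ => (1 : ℝ)) = (s ∩ t).indicator fun _ => (1 : ℝ) := by
      rw [Set.indicator_indicator]
    have e2 : s.indicator (μ[t.indicator fun _ => (1 : ℝ) | m']) =
        fun ω => s.indicator (fun _ => (1 : ℝ)) ω * (μ[t.indicator fun _ => (1 : ℝ) | m']) ω := by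
      ext ω
      by_cases hω : ω ∈ s <;> simp [hω]
    change ∫ ω, (s.indicator (t.indicator fun _ => (1 : ℝ))) ω ∂μ =
      ∫ ω, (s.indicator (μ[t.indicator fun _ => (1 : ℝ) | m'])) ω ∂μ
    rw [e1, e2, integral_mul_condExp h' (hI s hs') (hI t ht'), ← integral_condExp h',
      integral_congr_ae (hCI s t hs ht)]
    rfl
  -- a square-integrable function and an indicator function
  have hB : ∀ t, MeasurableSet[m₂] t → ∫ ω, f ω * t.indicator (fun _ => (1 : ℝ)) ω ∂μ =
      ∫ ω, f ω * (μ[t.indicator fun _ => (1 : ℝ) | m']) ω ∂μ := by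
    intro t ht
    have ht' := h₂ t ht
    have h0 := integral_mul_eq_zero_of_setIntegral h₁
      (h := fun ω => t.indicator (fun _ => (1 : ℝ)) ω - (μ[t.indicator fun _ => (1 : ℝ) | m']) ω)
      (((hI t ht').sub (hIc t ht')).integrable one_le_two) (fun s hs => hA s t hs ht) hf
      (hf2.integrable_mul ((hI t ht').sub (hIc t ht')))
    simp only [Pi.mul_apply, mul_sub] at h0
    have i1 : Integrable (fun ω => f ω * t.indicator (fun _ => (1 : ℝ)) ω) μ :=
      hf2.integrable_mul (hI t ht')
    have i2 : Integrable (fun ω => f ω * (μ[t.indicator fun _ => (1 : ℝ) | m']) ω) μ :=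
      hf2.integrable_mul (hIc t ht')
    rw [integral_sub i1 i2] at h0
    linarith
  have hC : ∀ t, MeasurableSet[m₂] t → ∫ ω in t, (f ω - (μ[f | m']) ω) ∂μ = 0 := by
    intro t ht
    have ht' := h₂ t ht
    have e : ∀ k : Ω → ℝ, ∫ ω in t, k ω ∂μ = ∫ ω, k ω * t.indicator (fun _ => (1 : ℝ)) ω ∂μ := by
      intro k
      rw [← integral_indicator ht']
      congr 1
      ext ω
      by_cases hω : ω ∈ t <;> simp [hω]
    rw [integral_sub (hf2.integrable one_le_two).integrableOn integrable_condExp.integrableOn,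
      e, e, hB t ht, integral_mul_condExp h' hf2 (hI t ht')]
    have := integral_mul_condExp h' (hI t ht') hf2
    simp only [mul_comm] at this ⊢
    rw [this]
    exact sub_self _
  have hD := integral_mul_eq_zero_of_setIntegral h₂ (h := fun ω => f ω - (μ[f | m']) ω)
    ((hf2.sub hfc).integrable one_le_two) hC hg (hg2.integrable_mul (hf2.sub hfc))
  have hE := integral_mul_condExp h' hf2 hg2
  have i1 : Integrable (fun ω => g ω * (f ω - (μ[f | m']) ω)) μ :=
    hg2.integrable_mul (hf2.sub hfc)
  have i2 : Integrable (fun ω => f ω * (μ[g | m']) ω) μ := hf2.integrable_mul hgc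
  have i3 : Integrable (fun ω => (μ[f | m']) ω * (μ[g | m']) ω) μ := hfc.integrable_mul hgc
  calc ∫ ω, (f ω - (μ[f | m']) ω) * (g ω - (μ[g | m']) ω) ∂μ
      = ∫ ω, (g ω * (f ω - (μ[f | m']) ω)
          - (f ω * (μ[g | m']) ω - (μ[f | m']) ω * (μ[g | m']) ω)) ∂μ := by
        congr 1; ext ω; ring
    _ = 0 := by
        have i4 : Integrable
            (fun ω => f ω * (μ[g | m']) ω - (μ[f | m']) ω * (μ[g | m']) ω) μ := i2.sub i3
        rw [integral_sub i1 i4, integral_sub i2 i3, hE, sub_self, sub_zero]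
        exact hD

/-- If `f` and `g` are conditionally independent, then their sum and their difference have the same
mean conditional variance, so that the one of the sum is at most `E (f - g)²`. -/
lemma IsCI.integral_sq_residual_add_le (h₁ : m₁ ≤ mΩ)
    (h₂ : m₂ ≤ mΩ) (h' : m' ≤ mΩ) (hCI : IsCI m₁ m₂ m' μ) {f g : Ω → ℝ}
    (hf : StronglyMeasurable[m₁] f) (hg : StronglyMeasurable[m₂] g) (hf2 : MemLp f 2 μ)
    (hg2 : MemLp g 2 μ) :
    ∫ ω, (f ω + g ω - (μ[f + g | m']) ω) ^ 2 ∂μ ≤ ∫ ω, (f ω - g ω) ^ 2 ∂μ := by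
  have h0 := hCI.integral_residual_mul_residual h₁ h₂ h' hf hg hf2 hg2
  have hd2 := hf2.sub hg2
  have hdc := hd2.condExp (m := m') one_le_two
  have hfc := hf2.condExp (m := m') one_le_two
  have hgc := hg2.condExp (m := m') one_le_two
  have ha := condExp_add (hf2.integrable one_le_two) (hg2.integrable one_le_two) m'
  have hs := condExp_sub (hf2.integrable one_le_two) (hg2.integrable one_le_two) m'
  have hE := integral_mul_condExp h' hd2 hd2
  have i1 : Integrable (fun ω => (f ω - g ω) ^ 2) μ := hd2.integrable_sq
  have i2 : Integrable (fun ω => (f - g) ω * (μ[f - g | m']) ω) μ := hd2.integrable_mul hdc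
  have i3 : Integrable (fun ω => (μ[f - g | m']) ω * (μ[f - g | m']) ω) μ :=
    hdc.integrable_mul hdc
  have i4 : Integrable (fun ω => (f ω - (μ[f | m']) ω) * (g ω - (μ[g | m']) ω)) μ :=
    (hf2.sub hfc).integrable_mul (hg2.sub hgc)
  have i5 : Integrable (fun ω => (f ω - g ω) ^ 2 - 2 * ((f - g) ω * (μ[f - g | m']) ω)) μ :=
    i1.sub (i2.const_mul 2)
  have i6 : Integrable (fun ω => (f ω - g ω) ^ 2 - 2 * ((f - g) ω * (μ[f - g | m']) ω)
      + (μ[f - g | m']) ω * (μ[f - g | m']) ω) μ := i5.add i3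
  have hpos : 0 ≤ ∫ ω, (μ[f - g | m']) ω * (μ[f - g | m']) ω ∂μ :=
    integral_nonneg fun ω => mul_self_nonneg _
  -- `(a + b)² = (a - b)² + 4 a b` for the residuals `a`, `b` of `f`, `g`, with `(a - b)²` expanded
  have hrw : (fun ω => (f ω + g ω - (μ[f + g | m']) ω) ^ 2) =ᵐ[μ] fun ω =>
      (f ω - g ω) ^ 2 - 2 * ((f - g) ω * (μ[f - g | m']) ω)
        + (μ[f - g | m']) ω * (μ[f - g | m']) ω
        + 4 * ((f ω - (μ[f | m']) ω) * (g ω - (μ[g | m']) ω)) := by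
    filter_upwards [ha, hs] with ω ha hs
    simp only [ha, hs, Pi.add_apply, Pi.sub_apply]
    ring
  rw [integral_congr_ae hrw, integral_add i6 (i4.const_mul 4), integral_add i5 i3,
    integral_sub i1 (i2.const_mul 2), integral_const_mul, integral_const_mul, h0, hE]
  linarith

end Residuals

/-! ### Mutual information with a standard Gaussian vector -/

/-- The logarithm of the density of the Gaussian law `N(m, r)` with respect to `N(0, 1)`. -/
noncomputable def logGaussianRatio (m r x : ℝ) : ℝ :=
  -(1 / 2) * Real.log r - (x - m) ^ 2 / (2 * r) + x ^ 2 / 2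

lemma measurable_logGaussianRatio (r : ℝ) :
    Measurable fun p : ℝ × ℝ => logGaussianRatio p.1 r p.2 := by
  unfold logGaussianRatio; fun_prop

lemma withDensity_logGaussianRatio (m : ℝ) {r : ℝ} (hr : 0 < r) :
    (gaussianReal 0 1).withDensity
      (fun x => ENNReal.ofReal (Real.exp (logGaussianRatio m r x))) =
      gaussianReal m r.toNNReal := by
  have hr' : r.toNNReal ≠ 0 := by simpa using hr
  have hm : Measurable fun x => ENNReal.ofReal (Real.exp (logGaussianRatio m r x)) :=
    ((measurable_logGaussianRatio r).comp (measurable_const.prodMk measurable_id)).exp.ennreal_ofReal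
  rw [gaussianReal_of_var_ne_zero 0 one_ne_zero, gaussianReal_of_var_ne_zero m hr',
    ← withDensity_mul _ (measurable_gaussianPDF 0 1) hm]
  congr 1
  ext1 x
  simp only [Pi.mul_apply, gaussianPDF]
  rw [← ENNReal.ofReal_mul (gaussianPDFReal_nonneg _ _ _)]
  congr 1
  simp only [gaussianPDFReal, logGaussianRatio, Real.coe_toNNReal r hr.le, NNReal.coe_one]
  have hsq : Real.exp (-(1 / 2) * Real.log r) = (√r)⁻¹ := by
    rw [Real.sqrt_eq_rpow, ← Real.rpow_neg hr.le, Real.rpow_def_of_pos hr]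
    congr 1; ring
  rw [Real.exp_add, Real.exp_sub, hsq, Real.sqrt_mul' _ hr.le, Real.sqrt_mul' _ zero_le_one]
  have e : Real.exp (-(x - 0) ^ 2 / (2 * 1)) * Real.exp (x ^ 2 / 2) = 1 := by
    rw [← Real.exp_add, Real.exp_eq_one_iff]; ring
  have e' : Real.exp (-(x - m) ^ 2 / (2 * r)) = (Real.exp ((x - m) ^ 2 / (2 * r)))⁻¹ := by
    rw [← Real.exp_neg]; congr 1; ring
  rw [e', Real.sqrt_one, mul_one, mul_inv]
  linear_combination (√(2 * Real.pi))⁻¹ * (√r)⁻¹ * (Real.exp ((x - m) ^ 2 / (2 * r)))⁻¹ * e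

lemma lintegral_exp_logGaussianRatio (m : ℝ) {r : ℝ} (hr : 0 < r) :
    ∫⁻ x, ENNReal.ofReal (Real.exp (logGaussianRatio m r x)) ∂gaussianReal 0 1 = 1 := by
  rw [← setLIntegral_univ, ← withDensity_apply _ MeasurableSet.univ,
    withDensity_logGaussianRatio m hr, measure_univ]

lemma lintegral_pi_prod {J : Type*} [Fintype J] {X : J → Type*} [∀ j, MeasurableSpace (X j)]
    (ν : ∀ j, Measure (X j)) [∀ j, IsProbabilityMeasure (ν j)] {f : ∀ j, X j → ℝ≥0∞}
    (hf : ∀ j, Measurable (f j)) :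
    ∫⁻ x, ∏ j, f j (x j) ∂Measure.pi ν = ∏ j, ∫⁻ x, f j x ∂ν j := by
  have h := lintegral_prod_eq_prod_lintegral_of_indepFun (μ := Measure.pi ν) Finset.univ
    (fun j x => f j (x j)) (iIndepFun_pi fun j => (hf j).aemeasurable)
    (fun j => (hf j).comp (measurable_pi_apply j))
  rw [h]
  refine Finset.prod_congr rfl fun j _ => ?_
  rw [← (measurePreserving_eval ν j).map_eq, lintegral_map (hf j) (measurable_pi_apply j)]

lemma integral_sq_gaussianReal : ∫ x, x ^ 2 ∂gaussianReal 0 1 = 1 := by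
  have h := variance_of_integral_eq_zero (μ := gaussianReal 0 1) (X := id) aemeasurable_id
    (by simp)
  rw [variance_id_gaussianReal] at h
  simpa using h.symm

/-- If the components of a standard Gaussian vector, which is a function of `Y`, are estimated from
`W` with mean square errors at most `r j`, then `I(Y; W)` is at least `∑ j, -(1 / 2) * log (r j)`.
The test function in the Donsker–Varadhan bound is the log-density of the Gaussian law with the
estimates as means and with variances `r j`. -/
lemma ofReal_sum_log_le_mutualInfo {Ω E 𝕎 J : Type*} [MeasurableSpace Ω] [MeasurableSpace E]
    [MeasurableSpace 𝕎] [Fintype J] {μ : Measure Ω} [IsProbabilityMeasure μ] {Y : Ω → E}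
    {W : Ω → 𝕎} (hY : Measurable Y) (hW : Measurable W) {x : J → E → ℝ} (hx : ∀ j, Measurable (x j))
    (hlaw : HasLaw (fun ω j => x j (Y ω)) (Measure.pi fun _ => gaussianReal 0 1) μ)
    {f : J → 𝕎 → ℝ} (hf : ∀ j, Measurable (f j)) {r : J → ℝ} (hr : ∀ j, 0 < r j)
    (hint : ∀ j, Integrable (fun ω => (x j (Y ω) - f j (W ω)) ^ 2) μ)
    (hle : ∀ j, ∫ ω, (x j (Y ω) - f j (W ω)) ^ 2 ∂μ ≤ r j) :
    ENNReal.ofReal (∑ j, -(1 / 2) * Real.log (r j)) ≤ mutualInfo Y W μ := by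
  have := Measure.isProbabilityMeasure_map (μ := μ) hY.aemeasurable
  have := Measure.isProbabilityMeasure_map (μ := μ) hW.aemeasurable
  have := Measure.isProbabilityMeasure_map (μ := μ) (hY.prodMk hW).aemeasurable
  set g : E × 𝕎 → ℝ := fun z => ∑ j, logGaussianRatio (f j z.2) (r j) (x j z.1) with hg
  have hgj : ∀ j, Measurable fun z : E × 𝕎 => logGaussianRatio (f j z.2) (r j) (x j z.1) :=
    fun j => by
      have h1 := hf j
      have h2 := hx j
      unfold logGaussianRatio
      fun_prop
  have hgm : Measurable g := Finset.measurable_fun_sum _ fun j _ => hgj j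
  have hmarg : ∀ j, HasLaw (fun ω => x j (Y ω)) (gaussianReal 0 1) μ := fun j =>
    (measurePreserving_eval (fun _ : J => gaussianReal 0 1) j).fun_comp_hasLaw hlaw
  have hsqi : ∀ j, Integrable (fun ω => x j (Y ω) ^ 2) μ := by
    intro j
    have : Integrable (fun t : ℝ => t ^ 2) (gaussianReal 0 1) :=
      (memLp_id_gaussianReal 2).integrable_sq
    rw [← (hmarg j).map_eq] at this
    exact this.comp_aemeasurable (hmarg j).aemeasurable
  have hsq : ∀ j, ∫ ω, x j (Y ω) ^ 2 ∂μ = 1 := by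
    intro j
    rw [← integral_sq_gaussianReal, ← (hmarg j).integral_comp (by fun_prop)]
    rfl
  have hterm : ∀ j, Integrable (fun ω => logGaussianRatio (f j (W ω)) (r j) (x j (Y ω))) μ := by
    intro j
    unfold logGaussianRatio
    exact ((integrable_const _).sub ((hint j).div_const _)).add ((hsqi j).div_const _)
  have hgint : Integrable g (μ.map fun ω => (Y ω, W ω)) := by
    rw [integrable_map_measure hgm.aestronglyMeasurable (hY.prodMk hW).aemeasurable]
    exact integrable_finsetSum _ fun j _ => hterm j
  refine le_trans (ENNReal.ofReal_le_ofReal ?_) (ofReal_integral_le_klDiv hgm hgint ?_)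
  · rw [integral_map (hY.prodMk hW).aemeasurable hgm.aestronglyMeasurable]
    simp only [hg]
    rw [integral_finsetSum _ fun j _ => hterm j]
    refine Finset.sum_le_sum fun j _ => ?_
    simp only [logGaussianRatio]
    have i1 : Integrable (fun ω => -(1 / 2) * Real.log (r j)
        - (x j (Y ω) - f j (W ω)) ^ 2 / (2 * r j)) μ :=
      (integrable_const _).sub ((hint j).div_const _)
    rw [integral_add i1 ((hsqi j).div_const _),
      integral_sub (integrable_const _) ((hint j).div_const _), integral_div, integral_div, hsq]
    have : (∫ ω, (x j (Y ω) - f j (W ω)) ^ 2 ∂μ) / (2 * r j) ≤ 1 / 2 := by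
      rw [div_le_iff₀ (by linarith [hr j])]
      linarith [hle j]
    simp only [integral_const, probReal_univ, smul_eq_mul]
    linarith
  · refine le_of_eq ?_
    have hm : Measurable fun z => ENNReal.ofReal (Real.exp (g z)) := hgm.exp.ennreal_ofReal
    rw [lintegral_prod_symm _ hm.aemeasurable]
    have hin : ∀ w, ∫⁻ y, ENNReal.ofReal (Real.exp (g (y, w))) ∂(μ.map Y) = 1 := by
      intro w
      have hφ : ∀ j, Measurable fun t : ℝ =>
          ENNReal.ofReal (Real.exp (logGaussianRatio (f j w) (r j) t)) := fun j =>
        ((measurable_logGaussianRatio (r j)).comp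
          (measurable_const.prodMk measurable_id)).exp.ennreal_ofReal
      have e : ∀ y, ENNReal.ofReal (Real.exp (g (y, w))) = ∏ j,
          ENNReal.ofReal (Real.exp (logGaussianRatio (f j w) (r j) (x j y))) := fun y => by
        rw [hg, Real.exp_sum, ENNReal.ofReal_prod_of_nonneg fun j _ => (Real.exp_pos _).le]
      simp only [e]
      have hφx : Measurable fun y => ∏ j,
          ENNReal.ofReal (Real.exp (logGaussianRatio (f j w) (r j) (x j y))) :=
        Finset.measurable_fun_prod _ fun j _ => (hφ j).comp (hx j)
      rw [lintegral_map hφx hY]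
      have h2 := hlaw.lintegral_comp (f := fun t : J → ℝ => ∏ j,
          ENNReal.ofReal (Real.exp (logGaussianRatio (f j w) (r j) (t j))))
        (Finset.measurable_fun_prod _ fun j _ => (hφ j).comp (measurable_pi_apply j)).aemeasurable
      rw [h2, lintegral_pi_prod _ hφ]
      simp [lintegral_exp_logGaussianRatio _ (hr _)]
    simp [hin]

/-! ### Mutual information of an additive Gaussian channel -/

lemma pi_withDensity_prod {J : Type*} [Fintype J] {X : J → Type*} [∀ j, MeasurableSpace (X j)]
    (ν : ∀ j, Measure (X j)) [∀ j, IsProbabilityMeasure (ν j)] {f : ∀ j, X j → ℝ≥0∞}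
    (hf : ∀ j, Measurable (f j)) [∀ j, SigmaFinite ((ν j).withDensity (f j))] :
    (Measure.pi ν).withDensity (fun x => ∏ j, f j (x j)) =
      Measure.pi fun j => (ν j).withDensity (f j) := by
  refine (Measure.pi_eq fun s hs => ?_).symm
  rw [withDensity_apply _ (MeasurableSet.univ_pi hs), ← lintegral_indicator (.univ_pi hs)]
  have e : (Set.univ.pi s).indicator (fun x => ∏ j, f j (x j)) =
      fun x => ∏ j, (s j).indicator (f j) (x j) := by
    ext x
    by_cases hx : x ∈ Set.univ.pi s
    · rw [Set.indicator_of_mem hx]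
      exact Finset.prod_congr rfl fun j _ => (Set.indicator_of_mem (hx j (Set.mem_univ j)) _).symm
    · rw [Set.indicator_of_notMem hx]
      obtain ⟨j, hj⟩ : ∃ j, x j ∉ s j := by simpa using hx
      exact (Finset.prod_eq_zero (Finset.mem_univ j) (Set.indicator_of_notMem hj _)).symm
  rw [e, lintegral_pi_prod ν fun j => (hf j).indicator (hs j)]
  refine Finset.prod_congr rfl fun j _ => ?_
  rw [lintegral_indicator (hs j), withDensity_apply _ (hs j)]

/-- If `W = c(Y) + b V` with standard Gaussian `V` independent of `Y`, and if `W` is standard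
Gaussian, then `I(Y; W) = -∑ j, log (b j)`. -/
lemma mutualInfo_gaussianChannel {Ω E J : Type*} [MeasurableSpace Ω] [MeasurableSpace E]
    [Fintype J] {μ : Measure Ω} [IsProbabilityMeasure μ] {Y : Ω → E} {V W : Ω → J → ℝ}
    (hY : Measurable Y) (hV : Measurable V) (hVY : IndepFun Y V μ)
    (hVlaw : HasLaw V (Measure.pi fun _ => gaussianReal 0 1) μ)
    (hWlaw : HasLaw W (Measure.pi fun _ => gaussianReal 0 1) μ)
    {c : J → E → ℝ} (hc : ∀ j, Measurable (c j)) {b : J → ℝ} (hb : ∀ j, 0 < b j)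
    (hW : ∀ ω j, W ω j = c j (Y ω) + b j * V ω j) :
    mutualInfo Y W μ = ENNReal.ofReal (∑ j, -(1 / 2) * Real.log (b j ^ 2)) := by
  have := Measure.isProbabilityMeasure_map (μ := μ) hY.aemeasurable
  set N : Measure (J → ℝ) := Measure.pi fun _ => gaussianReal 0 1 with hN
  set P := μ.map Y with hP
  set T : E × (J → ℝ) → E × (J → ℝ) := fun z => (z.1, fun j => c j z.1 + b j * z.2 j) with hTdef
  have hcm : ∀ j, Measurable fun z : E × (J → ℝ) => c j z.1 := fun j => (hc j).comp measurable_fst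
  have hT : Measurable T := by
    refine measurable_fst.prodMk (measurable_pi_lambda _ fun j => ?_)
    have := hcm j
    fun_prop
  have hWm : Measurable W := by
    refine measurable_pi_lambda _ fun j => ?_
    simp only [hW]
    have := (hc j).comp hY
    fun_prop
  have hYW : Measurable fun ω => (Y ω, W ω) := hY.prodMk hWm
  have hb2 : ∀ j, 0 < b j ^ 2 := fun j => pow_pos (hb j) 2
  set G : E × (J → ℝ) → ℝ := fun z => ∑ j, logGaussianRatio (c j z.1) (b j ^ 2) (z.2 j) with hG
  have hGm : Measurable G := by
    refine Finset.measurable_fun_sum _ fun j _ => ?_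
    have h1 := hcm j
    unfold logGaussianRatio
    fun_prop
  have hρ : Measurable fun z => ENNReal.ofReal (Real.exp (G z)) := hGm.exp.ennreal_ofReal
  -- the conditional law of `W` given `Y = y`
  have hcond : ∀ y, N.map (fun v j => c j y + b j * v j) =
      N.withDensity fun w => ENNReal.ofReal (Real.exp (G (y, w))) := by
    intro y
    have h1 : ∀ j, (gaussianReal 0 1).map (fun t => c j y + b j * t) =
        (gaussianReal 0 1).withDensity
          fun t => ENNReal.ofReal (Real.exp (logGaussianRatio (c j y) (b j ^ 2) t)) := by
      intro j
      rw [withDensity_logGaussianRatio _ (hb2 j)]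
      have : (fun t : ℝ => c j y + b j * t) = (fun t => t + c j y) ∘ fun t => b j * t := by
        ext t; simp [add_comm]
      rw [this, ← Measure.map_map (by fun_prop) (by fun_prop), gaussianReal_map_const_mul,
        gaussianReal_map_add_const]
      congr 1
      · simp
      · ext; simp [(hb2 j).le]
    have hφ : ∀ j, Measurable fun t : ℝ =>
        ENNReal.ofReal (Real.exp (logGaussianRatio (c j y) (b j ^ 2) t)) := fun j =>
      ((measurable_logGaussianRatio _).comp
        (measurable_const.prodMk measurable_id)).exp.ennreal_ofReal
    have hprob : ∀ j, IsProbabilityMeasure ((gaussianReal 0 1).map (fun t => c j y + b j * t)) :=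
      fun j => Measure.isProbabilityMeasure_map (by fun_prop)
    have hprob' : ∀ j, IsProbabilityMeasure ((gaussianReal 0 1).withDensity
        fun t => ENNReal.ofReal (Real.exp (logGaussianRatio (c j y) (b j ^ 2) t))) :=
      fun j => h1 j ▸ hprob j
    rw [hN, Measure.pi_map_pi (f := fun j t => c j y + b j * t) (fun j => by fun_prop)]
    simp only [h1]
    rw [← pi_withDensity_prod _ hφ]
    congr 1
    ext w
    rw [hG, Real.exp_sum, ENNReal.ofReal_prod_of_nonneg fun j _ => (Real.exp_pos _).le]
  -- hence the joint law has density `exp G` with respect to the product of the marginal laws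
  have hjoint : μ.map (fun ω => (Y ω, W ω)) =
      (P.prod N).withDensity fun z => ENNReal.ofReal (Real.exp (G z)) := by
    have e1 : μ.map (fun ω => (Y ω, W ω)) = (P.prod N).map T := by
      have := (indepFun_iff_map_prod_eq_prod_map_map hY.aemeasurable hV.aemeasurable).1 hVY
      rw [hP, ← hVlaw.map_eq, ← this, Measure.map_map hT (hY.prodMk hV)]
      congr 1
      ext ω
      · rfl
      · simp [hTdef, hW]
    rw [e1]
    refine Measure.ext_of_lintegral _ fun φ hφ => ?_
    have hφT : Measurable fun z => φ (T z) := hφ.comp hT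
    rw [lintegral_map hφ hT, lintegral_prod _ hφT.aemeasurable,
      lintegral_withDensity_eq_lintegral_mul _ hρ hφ, lintegral_prod _ (hρ.mul hφ).aemeasurable]
    refine lintegral_congr fun y => ?_
    have hφy : Measurable fun w => φ (y, w) := hφ.comp measurable_prodMk_left
    have hρy : Measurable fun w => ENNReal.ofReal (Real.exp (G (y, w))) :=
      hρ.comp measurable_prodMk_left
    have h2 := lintegral_map (μ := N) hφy (g := fun v j => c j y + b j * v j) (by fun_prop)
    rw [hcond y, lintegral_withDensity_eq_lintegral_mul _ hρy hφy] at h2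
    exact h2.symm
  have hac : μ.map (fun ω => (Y ω, W ω)) ≪ P.prod N := hjoint ▸ withDensity_absolutelyContinuous _ _
  have hllr : llr (μ.map fun ω => (Y ω, W ω)) (P.prod N) =ᵐ[μ.map fun ω => (Y ω, W ω)] G := by
    have h3 := Measure.rnDeriv_withDensity (P.prod N) hρ
    rw [← hjoint] at h3
    filter_upwards [hac.ae_le h3] with z hz
    simp [llr, hz, (Real.exp_pos _).le]
  have hsqi : ∀ X : Ω → J → ℝ, HasLaw X N μ → ∀ j, Integrable (fun ω => X ω j ^ 2) μ ∧
      ∫ ω, X ω j ^ 2 ∂μ = 1 := by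
    intro X hX j
    have hXj : HasLaw (fun ω => X ω j) (gaussianReal 0 1) μ :=
      (measurePreserving_eval (fun _ : J => gaussianReal 0 1) j).fun_comp_hasLaw hX
    constructor
    · have : Integrable (fun t : ℝ => t ^ 2) (gaussianReal 0 1) :=
        (memLp_id_gaussianReal 2).integrable_sq
      rw [← hXj.map_eq] at this
      exact this.comp_aemeasurable hXj.aemeasurable
    · rw [← integral_sq_gaussianReal, ← hXj.integral_comp (by fun_prop)]
      rfl
  -- `W - c(Y) = b V`, so that on the joint law the quadratic terms of `G` have the same mean
  have hGω : ∀ ω, G (Y ω, W ω) =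
      ∑ j, (-(1 / 2) * Real.log (b j ^ 2) - V ω j ^ 2 / 2 + W ω j ^ 2 / 2) := by
    intro ω
    refine Finset.sum_congr rfl fun j _ => ?_
    have h4 : W ω j - c j (Y ω) = b j * V ω j := by rw [hW]; ring
    simp only [logGaussianRatio, h4]
    have := (hb j).ne'
    field_simp
  have i1 : ∀ j, Integrable (fun ω => -(1 / 2) * Real.log (b j ^ 2) - V ω j ^ 2 / 2) μ := fun j =>
    (integrable_const _).sub ((hsqi V hVlaw j).1.div_const _)
  have i2 : ∀ j, Integrable
      (fun ω => -(1 / 2) * Real.log (b j ^ 2) - V ω j ^ 2 / 2 + W ω j ^ 2 / 2) μ := fun j =>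
    (i1 j).add ((hsqi W hWlaw j).1.div_const _)
  have hGint : Integrable G (μ.map fun ω => (Y ω, W ω)) := by
    rw [integrable_map_measure hGm.aestronglyMeasurable hYW.aemeasurable]
    exact (integrable_finsetSum _ fun j _ => i2 j).congr (.of_forall fun ω => (hGω ω).symm)
  have hGval : ∫ z, G z ∂(μ.map fun ω => (Y ω, W ω)) = ∑ j, -(1 / 2) * Real.log (b j ^ 2) := by
    rw [integral_map hYW.aemeasurable hGm.aestronglyMeasurable]
    simp only [hGω]
    rw [integral_finsetSum _ fun j _ => i2 j]
    refine Finset.sum_congr rfl fun j _ => ?_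
    rw [integral_add (i1 j) ((hsqi W hWlaw j).1.div_const _),
      integral_sub (integrable_const _) ((hsqi V hVlaw j).1.div_const _), integral_div,
      integral_div, (hsqi V hVlaw j).2, (hsqi W hWlaw j).2]
    simp
  have := Measure.isProbabilityMeasure_map (μ := μ) hYW.aemeasurable
  rw [mutualInfo, hWlaw.map_eq, InformationTheory.klDiv_of_ac_of_integrable hac
    ((integrable_congr hllr).2 hGint), integral_congr_ae hllr, hGval]
  simp

/-! ### Gaussian vectors with mean zero -/

section VecLemmas

variable {ι κ : Type} [Fintype ι] [Fintype κ] {n₁ n₂ k : ℕ}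

@[simp] lemma vcat_inl (x : Vec ι) (y : Vec κ) (i : ι) : vcat x y (Sum.inl i) = x i := rfl

@[simp] lemma vcat_inr (x : Vec ι) (y : Vec κ) (j : κ) : vcat x y (Sum.inr j) = y j := rfl

@[simp] lemma part1_apply (y : Vec (Idx n₁ n₂ k)) (i : Fin n₁) : part1 y i = y (Sum.inl i) := rfl

@[simp] lemma part2_apply (y : Vec (Idx n₁ n₂ k)) (i : Fin n₂) :
    part2 y i = y (Sum.inr (Sum.inl i)) := rfl

@[simp] lemma part3_apply (y : Vec (Idx n₁ n₂ k)) (i : Fin k) :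
    part3 y i = y (Sum.inr (Sum.inr i)) := rfl

lemma mulV_apply (A : Matrix ι κ ℝ) (x : Vec κ) (i : ι) : mulV A x i = A i ⬝ᵥ x.ofLp := rfl

@[simp] lemma mulV_diagonal [DecidableEq ι] (a : ι → ℝ) (x : Vec ι) (i : ι) :
    mulV (Matrix.diagonal a) x i = a i * x i := Matrix.mulVec_diagonal a x.ofLp i

@[fun_prop]
lemma measurable_vec_apply (i : ι) : Measurable fun x : Vec ι => x i := by fun_prop

lemma measurable_vec {Ω : Type*} [MeasurableSpace Ω] {X : Ω → Vec ι}
    (h : ∀ i, Measurable fun ω => X ω i) : Measurable X :=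
  (WithLp.measurable_toLp 2 (ι → ℝ)).comp (measurable_pi_lambda (fun ω => (X ω).ofLp) h)

lemma measurable_vcat : Measurable fun p : Vec ι × Vec κ => vcat p.1 p.2 := by
  refine measurable_vec ?_
  rintro (i | j)
  · exact (measurable_vec_apply i).comp measurable_fst
  · exact (measurable_vec_apply j).comp measurable_snd

@[fun_prop]
lemma measurable_mulV (A : Matrix ι κ ℝ) : Measurable (mulV A) := by
  refine measurable_vec fun i => ?_
  simp only [mulV_apply, dotProduct]
  fun_prop

@[fun_prop]
lemma measurable_part1 : Measurable (part1 : Vec (Idx n₁ n₂ k) → _) :=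
  measurable_vec fun _ => measurable_vec_apply _

@[fun_prop]
lemma measurable_part2 : Measurable (part2 : Vec (Idx n₁ n₂ k) → _) :=
  measurable_vec fun _ => measurable_vec_apply _

@[fun_prop]
lemma measurable_part3 : Measurable (part3 : Vec (Idx n₁ n₂ k) → _) :=
  measurable_vec fun _ => measurable_vec_apply _

end VecLemmas

section GaussianVectors

variable {Ω : Type*} [MeasurableSpace Ω] {μ : Measure Ω} {ι κ : Type} [Fintype ι] [Fintype κ]
  [DecidableEq ι] [DecidableEq κ]

lemma IsG0.hasGaussianLaw {X : Ω → Vec ι} {Q : Matrix ι ι ℝ} (hX : IsG0 X Q μ) :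
    HasGaussianLaw X μ := hX.2.hasGaussianLaw

lemma IsG0.congr {X X' : Ω → Vec ι} {Q : Matrix ι ι ℝ} (hX : IsG0 X Q μ) (h : X' =ᵐ[μ] X) :
    IsG0 X' Q μ := ⟨hX.1, hX.2.congr h⟩

lemma IsG0.covariance {X : Ω → Vec ι} {Q : Matrix ι ι ℝ} (hX : IsG0 X Q μ) (i j : ι) :
    cov[fun ω => X ω i, fun ω => X ω j; μ] = Q i j := by
  rw [← covariance_eval_multivariateGaussian (μ := 0) hX.1 i j]
  exact hX.2.covariance_fun_comp (f := fun x => x i) (g := fun x => x j) (by fun_prop)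
    (by fun_prop)

lemma IsG0.integral_apply {X : Ω → Vec ι} {Q : Matrix ι ι ℝ} (hX : IsG0 X Q μ) (i : ι) :
    ∫ ω, X ω i ∂μ = 0 := by
  have h1 := hX.2.integral_comp (f := fun x => x i) (by fun_prop)
  have h2 := (EuclideanSpace.proj (𝕜 := ℝ) i).integral_comp_comm
    (IsGaussian.integrable_id (μ := multivariateGaussian 0 Q))
  rw [integral_id_multivariateGaussian', map_zero] at h2
  exact h1.trans h2

lemma IsG0.memLp_apply {X : Ω → Vec ι} {Q : Matrix ι ι ℝ} (hX : IsG0 X Q μ) (i : ι) :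
    MemLp (fun ω => X ω i) 2 μ :=
  (hX.hasGaussianLaw.map_fun (EuclideanSpace.proj (𝕜 := ℝ) i)).memLp_two

lemma IsG0.integral_mul {X : Ω → Vec ι} {Q : Matrix ι ι ℝ} (hX : IsG0 X Q μ) (i j : ι) :
    ∫ ω, X ω i * X ω j ∂μ = Q i j := by
  have := hX.hasGaussianLaw.isProbabilityMeasure
  have h := covariance_eq_sub (hX.memLp_apply i) (hX.memLp_apply j)
  rw [hX.covariance, hX.integral_apply, zero_mul, sub_zero] at h
  exact h.symm

/-- Linear images of centred Gaussian vectors; the coordinates of `Z` are prescribed by the rows of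
`R`, and `R Q Rᵀ` is given by its entries. -/
lemma IsG0.of_linear {X : Ω → Vec ι} {Q : Matrix ι ι ℝ} (hX : IsG0 X Q μ) {Z : Ω → Vec κ}
    (R : κ → ι → ℝ) (hZ : ∀ᵐ ω ∂μ, ∀ k, Z ω k = R k ⬝ᵥ (X ω).ofLp) {Q' : Matrix κ κ ℝ}
    (hQ : ∀ k l, R k ⬝ᵥ Q *ᵥ R l = Q' k l) : IsG0 Z Q' μ := by
  obtain ⟨M, hM⟩ : ∃ M : Matrix κ ι ℝ, ∀ k, R k = M k := ⟨Matrix.of R, fun _ => rfl⟩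
  simp only [hM] at hZ hQ
  have hQ' : Q' = M * Q * Mᵀ := by
    ext k l
    rw [← hQ, Matrix.mul_assoc]
    simp only [Matrix.mul_apply, dotProduct, Matrix.mulVec, Matrix.transpose_apply]
  have hps : Q'.PosSemidef := by
    have := hX.1.mul_mul_conjTranspose_same M
    rwa [Matrix.conjTranspose_eq_transpose_of_trivial, ← hQ'] at this
  have hZ' : Z =ᵐ[μ] fun ω => mulV M (X ω) := by
    filter_upwards [hZ] with ω hω
    ext k
    rw [hω, mulV_apply]
  refine ⟨hps, HasLaw.congr ?_ hZ'⟩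
  have hm : Measurable (mulV M) := measurable_mulV M
  refine ⟨hm.comp_aemeasurable hX.2.aemeasurable, ?_⟩
  have e : μ.map (fun ω => mulV M (X ω)) = (multivariateGaussian 0 Q).map (mulV M) := by
    rw [← hX.2.map_eq, AEMeasurable.map_map_of_aemeasurable hm.aemeasurable hX.2.aemeasurable]
    rfl
  have := Measure.isProbabilityMeasure_map (μ := multivariateGaussian 0 Q) hm.aemeasurable
  rw [e]
  refine Measure.ext_of_charFun ?_
  ext t
  rw [charFun_multivariateGaussian hps]
  have h1 := charFun_multivariateGaussian (μ := 0) hX.1 (WithLp.toLp 2 (Mᵀ *ᵥ t.ofLp))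
  rw [charFun_apply] at h1 ⊢
  rw [integral_map hm.aemeasurable (by fun_prop)]
  have h2 : ∀ x : Vec ι, inner ℝ (mulV M x) t = inner ℝ x (WithLp.toLp 2 (Mᵀ *ᵥ t.ofLp)) := by
    intro x
    simp only [EuclideanSpace.inner_eq_star_dotProduct, star_trivial]
    change t.ofLp ⬝ᵥ M *ᵥ x.ofLp = (Mᵀ *ᵥ t.ofLp) ⬝ᵥ x.ofLp
    rw [Matrix.dotProduct_mulVec, Matrix.mulVec_transpose]
  simp only [h2, h1, inner_zero_right]
  congr 3
  rw [hQ']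
  simp only [← Matrix.mulVec_mulVec, Matrix.mulVec_transpose, Matrix.dotProduct_mulVec]

lemma IsG0.vcat_of_indepFun {A : Ω → Vec ι} {B : Ω → Vec κ} {Q₁ : Matrix ι ι ℝ}
    {Q₂ : Matrix κ κ ℝ} (hA : IsG0 A Q₁ μ) (hB : IsG0 B Q₂ μ) (h : IndepFun A B μ) :
    IsG0 (fun ω => vcat (A ω) (B ω)) (Matrix.fromBlocks Q₁ 0 0 Q₂) μ := by
  have := hA.hasGaussianLaw.isProbabilityMeasure
  have hps : (Matrix.fromBlocks Q₁ 0 0 Q₂).PosSemidef := by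
    refine Matrix.PosSemidef.of_dotProduct_mulVec_nonneg ?_ fun x => ?_
    · rw [Matrix.isHermitian_fromBlocks_iff]
      exact ⟨hA.1.1, by simp, by simp, hB.1.1⟩
    · obtain ⟨u, v, rfl⟩ : ∃ u v, x = Sum.elim u v := ⟨_, _, (Sum.elim_comp_inl_inr x).symm⟩
      have h1 := hA.1.dotProduct_mulVec_nonneg u
      have h2 := hB.1.dotProduct_mulVec_nonneg v
      simp only [star_trivial] at h1 h2 ⊢
      rw [Matrix.fromBlocks_mulVec, sumElim_dotProduct_sumElim]
      simpa using add_nonneg h1 h2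
  have hprod := (indepFun_iff_map_prod_eq_prod_map_map hA.2.aemeasurable hB.2.aemeasurable).1 h
  rw [hA.2.map_eq, hB.2.map_eq] at hprod
  refine ⟨hps, measurable_vcat.comp_aemeasurable
    (hA.2.aemeasurable.prodMk hB.2.aemeasurable), ?_⟩
  have e : μ.map (fun ω => vcat (A ω) (B ω)) = ((multivariateGaussian 0 Q₁).prod
      (multivariateGaussian 0 Q₂)).map fun p => vcat p.1 p.2 := by
    rw [← hprod, AEMeasurable.map_map_of_aemeasurable measurable_vcat.aemeasurable
      (hA.2.aemeasurable.prodMk hB.2.aemeasurable)]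
    rfl
  have := Measure.isProbabilityMeasure_map (μ := (multivariateGaussian 0 Q₁).prod
    (multivariateGaussian 0 Q₂)) (measurable_vcat (ι := ι) (κ := κ)).aemeasurable
  rw [e]
  refine Measure.ext_of_charFun ?_
  ext t
  set u : Vec ι := WithLp.toLp 2 fun i => t (Sum.inl i) with hu
  set v : Vec κ := WithLp.toLp 2 fun j => t (Sum.inr j) with hv
  have h1 := charFun_multivariateGaussian (μ := 0) hA.1 u
  have h2 := charFun_multivariateGaussian (μ := 0) hB.1 v
  rw [charFun_multivariateGaussian hps]
  rw [charFun_apply] at h1 h2 ⊢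
  rw [integral_map measurable_vcat.aemeasurable (by fun_prop)]
  have h3 : ∀ p : Vec ι × Vec κ, inner ℝ (vcat p.1 p.2) t = inner ℝ p.1 u + inner ℝ p.2 v := by
    intro p
    simp only [PiLp.inner_apply, Fintype.sum_sum_type]
    rfl
  simp only [h3, Complex.ofReal_add, add_mul, Complex.exp_add]
  rw [integral_prod_mul (μ := multivariateGaussian 0 Q₁) (ν := multivariateGaussian 0 Q₂)
    (fun x : Vec ι => Complex.exp ((inner ℝ x u : ℝ) * Complex.I))
    (fun x : Vec κ => Complex.exp ((inner ℝ x v : ℝ) * Complex.I)), h1, h2, ← Complex.exp_add]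
  congr 1
  have h4 : t.ofLp = Sum.elim u.ofLp v.ofLp := (Sum.elim_comp_inl_inr t.ofLp).symm
  rw [h4, Matrix.fromBlocks_mulVec, sumElim_dotProduct_sumElim]
  simp only [inner_zero_right, Sum.elim_comp_inl, Sum.elim_comp_inr, Matrix.zero_mulVec, add_zero,
    zero_add]
  push_cast
  ring

lemma IsG0.indepFun_of_vcat {A : Ω → Vec ι} {B : Ω → Vec κ} {Q : Matrix (ι ⊕ κ) (ι ⊕ κ) ℝ}
    (h : IsG0 (fun ω => vcat (A ω) (B ω)) Q μ) (h0 : ∀ i j, Q (Sum.inl i) (Sum.inr j) = 0) :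
    IndepFun A B μ := by
  have hg : HasGaussianLaw (fun ω => ((fun i => A ω i), fun j => B ω j)) μ := by
    let L : Vec (ι ⊕ κ) →L[ℝ] (ι → ℝ) × (κ → ℝ) :=
      (ContinuousLinearMap.pi fun i => EuclideanSpace.proj (𝕜 := ℝ) (Sum.inl i)).prod
        (ContinuousLinearMap.pi fun j => EuclideanSpace.proj (𝕜 := ℝ) (Sum.inr j))
    exact h.hasGaussianLaw.map_fun L
  have hi := hg.indepFun_of_covariance_eval fun i j =>
    (h.covariance (Sum.inl i) (Sum.inr j)).trans (h0 i j)
  exact hi.comp (WithLp.measurable_toLp 2 _) (WithLp.measurable_toLp 2 _)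

lemma IsG0.hasLaw_pi {X : Ω → Vec ι} (hX : IsG0 X 1 μ) :
    HasLaw (fun ω => (X ω).ofLp) (Measure.pi fun _ => gaussianReal 0 1) μ := by
  have hm := WithLp.measurable_ofLp 2 (ι → ℝ)
  refine ⟨hm.comp_aemeasurable hX.2.aemeasurable, ?_⟩
  have e : μ.map (fun ω => (X ω).ofLp) = (μ.map X).map (WithLp.ofLp : Vec ι → ι → ℝ) := by
    rw [AEMeasurable.map_map_of_aemeasurable hm.aemeasurable hX.2.aemeasurable]; rfl
  rw [e, hX.2.map_eq, multivariateGaussian_zero_one, ← map_pi_eq_stdGaussian,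
    Measure.map_map hm (WithLp.measurable_toLp 2 _)]
  exact Measure.map_id

end GaussianVectors

/-! ### Conditional independence from independent noises -/

section IndependentNoises

variable {Ω α β γ ζ₁ ζ₂ : Type*} [MeasurableSpace Ω] [MeasurableSpace α] [MeasurableSpace β]
  [MeasurableSpace γ] [MeasurableSpace ζ₁] [MeasurableSpace ζ₂] {μ : Measure Ω}
  [IsProbabilityMeasure μ]

lemma condExp_comp_of_indepFun {ζ : Type*} [MeasurableSpace ζ] [StandardBorelSpace ζ] [Nonempty ζ]
    {Z : Ω → ζ} {W : Ω → γ} (hZ : Measurable Z) (hW : Measurable W) (h : IndepFun Z W μ)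
    {f : γ × ζ → ℝ} (hf : StronglyMeasurable f) (hint : Integrable (fun ω => f (W ω, Z ω)) μ) :
    μ[fun ω => f (W ω, Z ω) | sigmaOf W] =ᵐ[μ] fun ω => ∫ z, f (W ω, z) ∂(μ.map Z) := by
  have := Measure.isProbabilityMeasure_map (μ := μ) hZ.aemeasurable
  have h1 : condDistrib Z W μ =ᵐ[μ.map W] Kernel.const γ (μ.map Z) := by
    refine condDistrib_ae_eq_of_measure_eq_compProd W hZ.aemeasurable ?_
    rw [Measure.compProd_const]
    exact (indepFun_iff_map_prod_eq_prod_map_map hW.aemeasurable hZ.aemeasurable).1 h.symm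
  refine (condExp_prod_ae_eq_integral_condDistrib hW hZ.aemeasurable hf hint).trans ?_
  filter_upwards [ae_of_ae_map hW.aemeasurable h1] with ω hω
  rw [hω, Kernel.const_apply]

/-- Functions of `(Z₁, W)` and of `(Z₂, W)`, with independent `Z₁`, `Z₂`, `W`, are conditionally
independent given `W`. -/
lemma isCIFun_of_indepFun [StandardBorelSpace ζ₁] [Nonempty ζ₁] [StandardBorelSpace ζ₂]
    [Nonempty ζ₂] {Z₁ : Ω → ζ₁} {Z₂ : Ω → ζ₂} {W : Ω → γ} {Y₁ : Ω → α} {Y₂ : Ω → β}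
    (hZ₁ : Measurable Z₁) (hZ₂ : Measurable Z₂) (hW : Measurable W) (hZZ : IndepFun Z₁ Z₂ μ)
    (hZW : IndepFun (fun ω => (Z₁ ω, Z₂ ω)) W μ) {φ₁ : γ × ζ₁ → α} {φ₂ : γ × ζ₂ → β}
    (hφ₁ : Measurable φ₁) (hφ₂ : Measurable φ₂) (hY₁ : Y₁ =ᵐ[μ] fun ω => φ₁ (W ω, Z₁ ω))
    (hY₂ : Y₂ =ᵐ[μ] fun ω => φ₂ (W ω, Z₂ ω)) : IsCIFun Y₁ Y₂ W μ := by
  rintro _ _ ⟨A, hA, rfl⟩ ⟨B, hB, rfl⟩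
  have h1 := hZW.comp measurable_fst measurable_id
  have h2 := hZW.comp measurable_snd measurable_id
  set f₁ : γ × ζ₁ → ℝ := (φ₁ ⁻¹' A).indicator fun _ => 1 with hf₁
  set f₂ : γ × ζ₂ → ℝ := (φ₂ ⁻¹' B).indicator fun _ => 1 with hf₂
  have hm₁ : StronglyMeasurable f₁ := stronglyMeasurable_const.indicator (hφ₁ hA)
  have hm₂ : StronglyMeasurable f₂ := stronglyMeasurable_const.indicator (hφ₂ hB)
  have e₁ : (Y₁ ⁻¹' A).indicator (fun _ => (1 : ℝ)) =ᵐ[μ] fun ω => f₁ (W ω, Z₁ ω) := by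
    filter_upwards [hY₁] with ω hω
    simp only [hf₁, Set.indicator]
    congr 1
    simp [hω]
  have e₂ : (Y₂ ⁻¹' B).indicator (fun _ => (1 : ℝ)) =ᵐ[μ] fun ω => f₂ (W ω, Z₂ ω) := by
    filter_upwards [hY₂] with ω hω
    simp only [hf₂, Set.indicator]
    congr 1
    simp [hω]
  have e₃ : (Y₁ ⁻¹' A ∩ Y₂ ⁻¹' B).indicator (fun _ => (1 : ℝ)) =ᵐ[μ]
      fun ω => f₁ (W ω, Z₁ ω) * f₂ (W ω, Z₂ ω) := by
    filter_upwards [e₁, e₂] with ω h h'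
    rw [← h, ← h', ← Set.inter_indicator_mul]
    simp
  have b₁ : ∀ p, ‖f₁ p‖ ≤ 1 := fun p =>
    (norm_indicator_le_norm_self _ _).trans (by simp)
  have b₂ : ∀ p, ‖f₂ p‖ ≤ 1 := fun p =>
    (norm_indicator_le_norm_self _ _).trans (by simp)
  have i₁ : Integrable (fun ω => f₁ (W ω, Z₁ ω)) μ := .of_bound
    (hm₁.comp_measurable (hW.prodMk hZ₁)).aestronglyMeasurable 1 (.of_forall fun _ => b₁ _)
  have i₂ : Integrable (fun ω => f₂ (W ω, Z₂ ω)) μ := .of_bound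
    (hm₂.comp_measurable (hW.prodMk hZ₂)).aestronglyMeasurable 1 (.of_forall fun _ => b₂ _)
  have hm₃ : StronglyMeasurable fun p : γ × (ζ₁ × ζ₂) => f₁ (p.1, p.2.1) * f₂ (p.1, p.2.2) :=
    (hm₁.comp_measurable (by fun_prop)).mul (hm₂.comp_measurable (by fun_prop))
  have i₃ : Integrable (fun ω => f₁ (W ω, Z₁ ω) * f₂ (W ω, Z₂ ω)) μ :=
    .of_bound (hm₃.comp_measurable (hW.prodMk (hZ₁.prodMk hZ₂))).aestronglyMeasurable 1
      (.of_forall fun _ => by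
        rw [norm_mul]; exact mul_le_one₀ (b₁ _) (norm_nonneg _) (b₂ _))
  have c₁ := condExp_comp_of_indepFun hZ₁ hW h1 hm₁ i₁
  have c₂ := condExp_comp_of_indepFun hZ₂ hW h2 hm₂ i₂
  have c₃ := condExp_comp_of_indepFun (hZ₁.prodMk hZ₂) hW hZW hm₃ i₃
  have hlaw := (indepFun_iff_map_prod_eq_prod_map_map hZ₁.aemeasurable hZ₂.aemeasurable).1 hZZ
  have := Measure.isProbabilityMeasure_map (μ := μ) hZ₁.aemeasurable
  have := Measure.isProbabilityMeasure_map (μ := μ) hZ₂.aemeasurable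
  filter_upwards [condExp_congr_ae (m := sigmaOf W) e₁, condExp_congr_ae (m := sigmaOf W) e₂,
    condExp_congr_ae (m := sigmaOf W) e₃, c₁, c₂, c₃] with ω g₁ g₂ g₃ k₁ k₂ k₃
  rw [Pi.mul_apply, g₁, g₂, g₃, k₁, k₂, k₃, hlaw]
  exact integral_prod_mul (fun z => f₁ (W ω, z)) (fun z => f₂ (W ω, z))

end IndependentNoises

/-! ### The common variable `W*` and the noises -/

section CommonVariable

variable {Ω : Type*} [MeasurableSpace Ω] {μ : Measure Ω} {n₁ n₂ k₁ k₂ : ℕ} {d : Fin n₂ → ℝ}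
  {Y₁ : Ω → Vec (Idx n₁ n₂ k₁)} {Y₂ : Ω → Vec (Idx n₁ n₂ k₂)} {V : Ω → Vec (Fin n₂)}

lemma IsG0.of_submatrix {ι κ : Type} [Fintype ι] [Fintype κ] [DecidableEq ι] [DecidableEq κ]
    {X : Ω → Vec ι} {Q : Matrix ι ι ℝ} (hX : IsG0 X Q μ) {Z : Ω → Vec κ} (e : κ → ι)
    (hZ : ∀ ω k, Z ω k = X ω (e k)) {Q' : Matrix κ κ ℝ} (hQ : ∀ k l, Q (e k) (e l) = Q' k l) :
    IsG0 Z Q' μ :=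
  hX.of_linear (fun k => Pi.single (e k) 1)
    (.of_forall fun ω k => by simp [hZ]) fun k l => by simp [← hQ]

lemma wStar2_apply {Ω : Type*} {Y₁ : Ω → Vec (Idx n₁ n₂ k₁)} {Y₂ : Ω → Vec (Idx n₁ n₂ k₂)}
    {V : Ω → Vec (Fin n₂)} (ω : Ω) (l : Fin n₂) : wStar2 d Y₁ Y₂ V ω l =
    √(d l) / (1 + d l) * Y₁ ω (Sum.inr (Sum.inl l))
      + √(d l) / (1 + d l) * Y₂ ω (Sum.inr (Sum.inl l)) + √(1 - d l) / √(1 + d l) * V ω l := by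
  simp only [wStar2, matL, matL3, PiLp.add_apply, mulV_diagonal, part2_apply]

lemma IsCanonical.measurable_wStar2 (hY : IsCanonical d Y₁ Y₂ μ) (hV : Measurable V) :
    Measurable (wStar2 d Y₁ Y₂ V) := by
  have h₁ := hY.measurable_left
  have h₂ := hY.measurable_right
  refine measurable_vec fun l => ?_
  simp only [wStar2_apply]
  have a₁ := (measurable_vec_apply (Sum.inr (Sum.inl l))).comp h₁
  have a₂ := (measurable_vec_apply (Sum.inr (Sum.inl l))).comp h₂
  have a₃ := (measurable_vec_apply l).comp hV
  exact ((a₁.const_mul _).add (a₂.const_mul _)).add (a₃.const_mul _)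

lemma IsCanonical.measurable_wStar (hY : IsCanonical d Y₁ Y₂ μ) (hV : Measurable V) :
    Measurable (wStar d Y₁ Y₂ V) :=
  measurable_vcat.comp
    ((measurable_part1.comp hY.measurable_left).prodMk (hY.measurable_wStar2 hV))

/-- The rows of the matrix which maps `(Y₁, Y₂, V)` to `(Y₁, Y₂, W*)`. -/
noncomputable def tripleRow (n₁ k₁ k₂ : ℕ) (d : Fin n₂ → ℝ) :
    (Idx n₁ n₂ k₁ ⊕ Idx n₁ n₂ k₂) ⊕ (Fin n₁ ⊕ Fin n₂) →
      (Idx n₁ n₂ k₁ ⊕ Idx n₁ n₂ k₂) ⊕ Fin n₂ → ℝ :=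
  Sum.elim (fun a => Pi.single (Sum.inl a) 1) <| Sum.elim
    (fun i => Pi.single (Sum.inl (Sum.inl (Sum.inl i))) 1) fun l =>
      (√(d l) / (1 + d l)) • Pi.single (Sum.inl (Sum.inl (Sum.inr (Sum.inl l)))) 1
        + (√(d l) / (1 + d l)) • Pi.single (Sum.inl (Sum.inr (Sum.inr (Sum.inl l)))) 1
        + (√(1 - d l) / √(1 + d l)) • Pi.single (Sum.inr l) 1

/-- The matrix with rows `tripleRow` turns the variance matrix of `(Y₁, Y₂, V)` into that of
`(Y₁, Y₂, W*)`. -/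
lemma tripleRow_dotProduct_mulVec (hpos : ∀ i, 0 < d i) (hlt : ∀ i, d i < 1)
    (p q : (Idx n₁ n₂ k₁ ⊕ Idx n₁ n₂ k₂) ⊕ (Fin n₁ ⊕ Fin n₂)) :
    tripleRow n₁ k₁ k₂ d p ⬝ᵥ Matrix.fromBlocks (qCvf n₁ k₁ k₂ d) 0 0 1 *ᵥ tripleRow n₁ k₁ k₂ d q =
      qTriple n₁ k₁ k₂ d p q := by
  have hs : ∀ l, √(d l) * √(d l) = d l := fun l => Real.mul_self_sqrt (hpos l).le
  have hp : ∀ l, 0 < 1 + d l := fun l => by linarith [hpos l]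
  have hsp : ∀ l, √(1 + d l) * √(1 + d l) = 1 + d l := fun l => Real.mul_self_sqrt (hp l).le
  have hsm : ∀ l, √(1 - d l) * √(1 - d l) = 1 - d l := fun l =>
    Real.mul_self_sqrt (by linarith [hlt l])
  have key : ∀ l, √(d l) / (1 + d l) + √(d l) / (1 + d l) * d l = √(d l) := fun l => by
    have := (hp l).ne'
    field_simp
  have key2 : ∀ l, √(d l) / (1 + d l) * √(d l) + √(d l) / (1 + d l) * √(d l)
      + √(1 - d l) / √(1 + d l) * (√(1 - d l) / √(1 + d l)) = 1 := fun l => by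
    have h1 := (hp l).ne'
    rw [div_mul_div_comm, hsm, hsp, div_mul_eq_mul_div, hs]
    field_simp
    ring
  set M := Matrix.fromBlocks (qCvf n₁ k₁ k₂ d) 0 0 (1 : Matrix (Fin n₂) (Fin n₂) ℝ) with hM
  -- covariances with the components of `W₂*`
  have hW : ∀ l a, (M *ᵥ tripleRow n₁ k₁ k₂ d (Sum.inr (Sum.inr l))) (Sum.inl a) =
      qTriple n₁ k₁ k₂ d (Sum.inl a) (Sum.inr (Sum.inr l)) := by
    intro l a
    simp only [tripleRow, Sum.elim_inr, Matrix.mulVec_add, Matrix.mulVec_smul,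
      Matrix.mulVec_single_one, Pi.add_apply, Pi.smul_apply, Matrix.col_apply, smul_eq_mul, hM,
      Matrix.fromBlocks_apply₁₁, Matrix.fromBlocks_apply₁₂, Matrix.zero_apply, mul_zero, add_zero]
    rcases a with (a | a | a) | (a | a | a) <;>
      simp only [qTriple, qCvf, cvfCross, loadW, sqrtD, Matrix.one_apply, Matrix.transpose_apply,
        Matrix.fromBlocks_apply₁₁, Matrix.fromBlocks_apply₁₂, Matrix.fromBlocks_apply₂₁,
        Matrix.fromBlocks_apply₂₂, Matrix.fromRows_apply_inl, Matrix.fromRows_apply_inr,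
        Matrix.zero_apply, Matrix.diagonal_apply, reduceCtorEq, if_false, mul_zero, add_zero,
        Sum.inr.injEq, Sum.inl.injEq, eq_comm (a := l)]
    all_goals split_ifs with h
    all_goals first
      | rfl
      | (subst h; linarith [key a])
      | simp
  have hWW : ∀ k l, (M *ᵥ tripleRow n₁ k₁ k₂ d (Sum.inr (Sum.inr l))) (Sum.inr k) =
      √(1 - d l) / √(1 + d l) * if k = l then 1 else 0 := by
    intro k l
    simp only [tripleRow, Sum.elim_inr, Matrix.mulVec_add, Matrix.mulVec_smul,
      Matrix.mulVec_single_one, Pi.add_apply, Pi.smul_apply, Matrix.col_apply, smul_eq_mul, hM,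
      Matrix.fromBlocks_apply₂₁, Matrix.fromBlocks_apply₂₂, Matrix.zero_apply, mul_zero, zero_add,
      Matrix.one_apply]
  have hMT : Mᵀ = M := by
    simp [hM, Matrix.fromBlocks_transpose, qCvf]
  have hQT : (qTriple n₁ k₁ k₂ d)ᵀ = qTriple n₁ k₁ k₂ d := by
    simp [Matrix.fromBlocks_transpose, qCvf, qTriple]
  have hsymm : ∀ u v, u ⬝ᵥ M *ᵥ v = v ⬝ᵥ M *ᵥ u := by
    intro u v
    rw [dotProduct_comm, Matrix.dotProduct_mulVec, ← Matrix.mulVec_transpose, hMT]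
  have h₁₂ : ∀ a i, tripleRow n₁ k₁ k₂ d (Sum.inl a) ⬝ᵥ
      M *ᵥ tripleRow n₁ k₁ k₂ d (Sum.inr (Sum.inl i)) =
      qTriple n₁ k₁ k₂ d (Sum.inl a) (Sum.inr (Sum.inl i)) := by
    intro a i
    simp only [tripleRow, Sum.elim_inl, Sum.elim_inr, single_one_dotProduct,
      Matrix.mulVec_single_one, Matrix.col_apply, hM, Matrix.fromBlocks_apply₁₁]
    rcases a with (a | a | a) | (a | a | a) <;>
      simp [qTriple, qCvf, cvfCross, loadW, Matrix.one_apply, eq_comm]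
  have h₁₃ : ∀ a l, tripleRow n₁ k₁ k₂ d (Sum.inl a) ⬝ᵥ
      M *ᵥ tripleRow n₁ k₁ k₂ d (Sum.inr (Sum.inr l)) =
      qTriple n₁ k₁ k₂ d (Sum.inl a) (Sum.inr (Sum.inr l)) := by
    intro a l
    rw [← hW]
    simp only [tripleRow, Sum.elim_inl, single_one_dotProduct]
  have h₂₃ : ∀ i l, tripleRow n₁ k₁ k₂ d (Sum.inr (Sum.inl i)) ⬝ᵥ
      M *ᵥ tripleRow n₁ k₁ k₂ d (Sum.inr (Sum.inr l)) =
      qTriple n₁ k₁ k₂ d (Sum.inr (Sum.inl i)) (Sum.inr (Sum.inr l)) := by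
    intro i l
    have h := hW l (Sum.inl (Sum.inl i))
    simp only [tripleRow, Sum.elim_inl, Sum.elim_inr, single_one_dotProduct] at h ⊢
    rw [h]
    simp [qTriple, loadW]
  rcases p with a | i | k <;> rcases q with b | j | l
  · simp [tripleRow, qTriple, hM]
  · exact h₁₂ a j
  · exact h₁₃ a l
  · rw [hsymm, h₁₂, ← hQT, Matrix.transpose_apply, hQT]
  · simp [tripleRow, qTriple, hM, qCvf, Matrix.one_apply]
  · exact h₂₃ i l
  · rw [hsymm, h₁₃, ← hQT, Matrix.transpose_apply, hQT]
  · rw [hsymm, h₂₃, ← hQT, Matrix.transpose_apply, hQT]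
  · have h : tripleRow n₁ k₁ k₂ d (Sum.inr (Sum.inr k)) =
        (√(d k) / (1 + d k)) • Pi.single (Sum.inl (Sum.inl (Sum.inr (Sum.inl k)))) 1
        + (√(d k) / (1 + d k)) • Pi.single (Sum.inl (Sum.inr (Sum.inr (Sum.inl k)))) 1
        + (√(1 - d k) / √(1 + d k)) • Pi.single (Sum.inr k) 1 := rfl
    rw [h]
    simp only [add_dotProduct, smul_dotProduct, single_one_dotProduct, hW, hWW]
    simp only [qTriple, loadW, sqrtD, Matrix.one_apply, Matrix.fromBlocks_apply₁₂,
      Matrix.fromBlocks_apply₂₂, Matrix.fromRows_apply_inl, Matrix.fromRows_apply_inr,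
      Matrix.diagonal_apply, Sum.inr.injEq, smul_eq_mul]
    split_ifs with h
    · subst h
      linarith [key2 k]
    · simp

/-- The joint law of `(Y₁, Y₂, W*)`. -/
lemma IsCanonical.isG0_triple (hY : IsCanonical d Y₁ Y₂ μ) (hV : IsG0 V 1 μ)
    (hVY : IndepFun V (fun ω => (Y₁ ω, Y₂ ω)) μ) :
    IsG0 (fun ω => vcat (vcat (Y₁ ω) (Y₂ ω)) (wStar d Y₁ Y₂ V ω)) (qTriple n₁ k₁ k₂ d) μ := by
  have hX := hY.law.vcat_of_indepFun hV ((hVY.symm.comp measurable_vcat measurable_id :))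
  refine hX.of_linear (tripleRow n₁ k₁ k₂ d) (.of_forall fun ω => ?_)
    (tripleRow_dotProduct_mulVec hY.pos hY.lt_one)
  rintro (a | i | l)
  · simp [tripleRow]
  · simp [tripleRow, wStar, wStar1]
  · simp [tripleRow, wStar, wStar2_apply, add_dotProduct]

/-- The first parts of the two vectors coincide almost surely, because the variance of their
difference is zero. -/
lemma IsCanonical.part1_ae_eq (hY : IsCanonical d Y₁ Y₂ μ) :
    ∀ᵐ ω ∂μ, ∀ i, Y₁ ω (Sum.inl i) = Y₂ ω (Sum.inl i) := by
  rw [ae_all_iff]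
  intro i
  have h₁ := hY.law.memLp_apply (Sum.inl (Sum.inl i))
  have h₂ := hY.law.memLp_apply (Sum.inr (Sum.inl i))
  have h0 : ∫ ω, (Y₁ ω (Sum.inl i) - Y₂ ω (Sum.inl i)) ^ 2 ∂μ = 0 := by
    have i₁ : Integrable (fun ω => Y₁ ω (Sum.inl i) * Y₁ ω (Sum.inl i)) μ := h₁.integrable_mul h₁
    have i₂ : Integrable (fun ω => Y₁ ω (Sum.inl i) * Y₂ ω (Sum.inl i)) μ := h₁.integrable_mul h₂
    have i₃ : Integrable (fun ω => Y₂ ω (Sum.inl i) * Y₂ ω (Sum.inl i)) μ := h₂.integrable_mul h₂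
    have e₁ := hY.law.integral_mul (Sum.inl (Sum.inl i)) (Sum.inl (Sum.inl i))
    have e₂ := hY.law.integral_mul (Sum.inl (Sum.inl i)) (Sum.inr (Sum.inl i))
    have e₃ := hY.law.integral_mul (Sum.inr (Sum.inl i)) (Sum.inr (Sum.inl i))
    simp only [vcat_inl, vcat_inr, qCvf, cvfCross, Matrix.fromBlocks_apply₁₁,
      Matrix.fromBlocks_apply₁₂, Matrix.fromBlocks_apply₂₂, Matrix.one_apply_eq] at e₁ e₂ e₃
    have e : ∀ ω, (Y₁ ω (Sum.inl i) - Y₂ ω (Sum.inl i)) ^ 2 =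
        Y₁ ω (Sum.inl i) * Y₁ ω (Sum.inl i) - 2 * (Y₁ ω (Sum.inl i) * Y₂ ω (Sum.inl i))
          + Y₂ ω (Sum.inl i) * Y₂ ω (Sum.inl i) := fun ω => by ring
    have i₄ : Integrable (fun ω => Y₁ ω (Sum.inl i) * Y₁ ω (Sum.inl i)
        - 2 * (Y₁ ω (Sum.inl i) * Y₂ ω (Sum.inl i))) μ := i₁.sub (i₂.const_mul 2)
    simp only [e]
    rw [integral_add i₄ i₃, integral_sub i₁ (i₂.const_mul 2), integral_const_mul, e₁, e₂, e₃]
    norm_num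
  have hint : Integrable (fun ω => (Y₁ ω (Sum.inl i) - Y₂ ω (Sum.inl i)) ^ 2) μ :=
    (h₁.sub h₂).integrable_sq
  filter_upwards [(integral_eq_zero_iff_of_nonneg (fun ω => sq_nonneg _) hint).1 h0] with ω hω
  simpa [sub_eq_zero] using hω

/-- The noise vector `(Y_{·2} - D^{1/2} W, Y_{·3})`; it is a version of `noise` in which the
conditional expectation is replaced by its value. -/
noncomputable def linearNoise {k : ℕ} (d : Fin n₂ → ℝ) (Y : Ω → Vec (Idx n₁ n₂ k))
    (W : Ω → Vec (Fin n₂)) : Ω → Vec (Fin n₂ ⊕ Fin k) := fun ω =>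
  vcat (part2 (Y ω) - mulV (sqrtD d) (W ω)) (part3 (Y ω))

lemma measurable_linearNoise {k : ℕ} {Y : Ω → Vec (Idx n₁ n₂ k)} {W : Ω → Vec (Fin n₂)}
    (hY : Measurable Y) (hW : Measurable W) : Measurable (linearNoise d Y W) :=
  measurable_vcat.comp (((measurable_part2.comp hY).sub ((measurable_mulV _).comp hW)).prodMk
    (measurable_part3.comp hY))

/-- The rows of the matrix which maps `(Y₁, Y₂, W*)` to `(Z₁, Z₂, W*)`. -/
noncomputable def noiseRow (n₁ k₁ k₂ : ℕ) (d : Fin n₂ → ℝ) :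
    ((Fin n₂ ⊕ Fin k₁) ⊕ (Fin n₂ ⊕ Fin k₂)) ⊕ (Fin n₁ ⊕ Fin n₂) →
      (Idx n₁ n₂ k₁ ⊕ Idx n₁ n₂ k₂) ⊕ (Fin n₁ ⊕ Fin n₂) → ℝ :=
  Sum.elim (Sum.elim
    (Sum.elim (fun l => Pi.single (Sum.inl (Sum.inl (Sum.inr (Sum.inl l)))) 1
        - √(d l) • Pi.single (Sum.inr (Sum.inr l)) 1)
      fun i => Pi.single (Sum.inl (Sum.inl (Sum.inr (Sum.inr i)))) 1)
    (Sum.elim (fun l => Pi.single (Sum.inl (Sum.inr (Sum.inr (Sum.inl l)))) 1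
        - √(d l) • Pi.single (Sum.inr (Sum.inr l)) 1)
      fun i => Pi.single (Sum.inl (Sum.inr (Sum.inr (Sum.inr i)))) 1))
    fun a => Pi.single (Sum.inr a) 1

/-- The matrix with rows `noiseRow` turns the variance matrix of `(Y₁, Y₂, W*)` into a
block-diagonal one. -/
lemma noiseRow_dotProduct_mulVec (hpos : ∀ i, 0 < d i)
    (p q : ((Fin n₂ ⊕ Fin k₁) ⊕ (Fin n₂ ⊕ Fin k₂)) ⊕ (Fin n₁ ⊕ Fin n₂)) :
    noiseRow n₁ k₁ k₂ d p ⬝ᵥ qTriple n₁ k₁ k₂ d *ᵥ noiseRow n₁ k₁ k₂ d q =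
      Matrix.fromBlocks (Matrix.fromBlocks (qNoise k₁ d) 0 0 (qNoise k₂ d)) 0 0 1 p q := by
  have hs : ∀ l, √(d l) * √(d l) = d l := fun l => Real.mul_self_sqrt (hpos l).le
  rcases p with ((i | i) | (i | i)) | (i | i) <;> rcases q with ((j | j) | (j | j)) | (j | j)
  all_goals
    simp only [noiseRow, Sum.elim_inl, Sum.elim_inr, sub_dotProduct, smul_dotProduct,
      single_one_dotProduct, Matrix.mulVec_sub, Matrix.mulVec_smul, Matrix.mulVec_single_one,
      Pi.sub_apply, Pi.smul_apply, Matrix.col_apply, smul_eq_mul]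
    simp only [qTriple, qCvf, cvfCross, loadW, sqrtD, qNoise, Matrix.one_apply,
      Matrix.transpose_apply, Matrix.fromBlocks_apply₁₁, Matrix.fromBlocks_apply₁₂,
      Matrix.fromBlocks_apply₂₁, Matrix.fromBlocks_apply₂₂, Matrix.fromRows_apply_inl,
      Matrix.fromRows_apply_inr, Matrix.zero_apply, Matrix.sub_apply, Matrix.diagonal_apply,
      reduceCtorEq, if_false, Sum.inr.injEq, Sum.inl.injEq, mul_zero, sub_zero,
      eq_comm (a := j)]
  all_goals first
    | done
    | (split_ifs with h
       · subst h; linarith [hs i]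
       · simp)

end CommonVariable

/-! ### The realization of the pair by `W*` and independent noises -/

section Realization

variable {Ω : Type*} [MeasurableSpace Ω] {μ : Measure Ω} {n₁ n₂ k₁ k₂ : ℕ} {d : Fin n₂ → ℝ}
  {Y₁ : Ω → Vec (Idx n₁ n₂ k₁)} {Y₂ : Ω → Vec (Idx n₁ n₂ k₂)} {V : Ω → Vec (Fin n₂)}

/-- The joint law of the noises and of `W*`. -/
lemma IsCanonical.isG0_noise_triple (hY : IsCanonical d Y₁ Y₂ μ) (hV : IsG0 V 1 μ)
    (hVY : IndepFun V (fun ω => (Y₁ ω, Y₂ ω)) μ) :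
    IsG0 (fun ω => vcat (vcat (linearNoise d Y₁ (wStar2 d Y₁ Y₂ V) ω)
        (linearNoise d Y₂ (wStar2 d Y₁ Y₂ V) ω)) (wStar d Y₁ Y₂ V ω))
      (Matrix.fromBlocks (Matrix.fromBlocks (qNoise k₁ d) 0 0 (qNoise k₂ d)) 0 0 1) μ := by
  refine (hY.isG0_triple hV hVY).of_linear (noiseRow n₁ k₁ k₂ d) (.of_forall fun ω => ?_)
    (noiseRow_dotProduct_mulVec hY.pos)
  rintro (((l | i) | (l | i)) | a) <;>
    simp [noiseRow, linearNoise, sqrtD, wStar, sub_dotProduct]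

lemma IsCanonical.isG0_qS (hY : IsCanonical d Y₁ Y₂ μ) (hV : IsG0 V 1 μ)
    (hVY : IndepFun V (fun ω => (Y₁ ω, Y₂ ω)) μ) :
    IsG0 (fun ω => vcat (vcat (part2 (Y₁ ω)) (part2 (Y₂ ω))) (wStar2 d Y₁ Y₂ V ω)) (qS d 1) μ := by
  refine (hY.isG0_triple hV hVY).of_submatrix
    (Sum.elim (Sum.elim (fun l => Sum.inl (Sum.inl (Sum.inr (Sum.inl l))))
      fun l => Sum.inl (Sum.inr (Sum.inr (Sum.inl l)))) fun l => Sum.inr (Sum.inr l)) ?_ ?_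
  · rintro ω ((l | l) | l) <;> rfl
  · rintro ((i | i) | i) ((j | j) | j) <;>
      simp [qTriple, qCvf, cvfCross, loadW, qS, Matrix.one_apply, sqrtD, Matrix.diagonal_apply,
        eq_comm]
    all_goals
      by_cases h : i = j
      · simp [h]
      · simp [h]

lemma IsG0.of_vcat_left {ι κ : Type} [Fintype ι] [Fintype κ] [DecidableEq ι] [DecidableEq κ]
    {A : Ω → Vec ι} {B : Ω → Vec κ} {Q : Matrix (ι ⊕ κ) (ι ⊕ κ) ℝ}
    (h : IsG0 (fun ω => vcat (A ω) (B ω)) Q μ) : IsG0 A Q.toBlocks₁₁ μ :=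
  h.of_submatrix Sum.inl (fun _ _ => rfl) fun _ _ => rfl

lemma IsG0.of_vcat_right {ι κ : Type} [Fintype ι] [Fintype κ] [DecidableEq ι] [DecidableEq κ]
    {A : Ω → Vec ι} {B : Ω → Vec κ} {Q : Matrix (ι ⊕ κ) (ι ⊕ κ) ℝ}
    (h : IsG0 (fun ω => vcat (A ω) (B ω)) Q μ) : IsG0 B Q.toBlocks₂₂ μ :=
  h.of_submatrix Sum.inr (fun _ _ => rfl) fun _ _ => rfl

lemma IsG0.integral_eq_zero {ι : Type} [Fintype ι] [DecidableEq ι] {X : Ω → Vec ι}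
    {Q : Matrix ι ι ℝ} (hX : IsG0 X Q μ) : ∫ ω, X ω ∂μ = 0 := by
  rw [hX.2.integral_eq]
  exact integral_id_multivariateGaussian

/-- A vector `Y` is determined by its common part and its noise. -/
lemma eq_loadW_add_loadZ {Ω : Type*} {k : ℕ} {Y : Ω → Vec (Idx n₁ n₂ k)} {W₂ : Ω → Vec (Fin n₂)}
    {w₁ : Vec (Fin n₁)} {ω : Ω} (h : ∀ i, Y ω (Sum.inl i) = w₁ i) :
    Y ω = mulV (loadW n₁ k (sqrtD d)) (vcat w₁ (W₂ ω))
      + mulV (loadZ n₁ n₂ k) (linearNoise d Y W₂ ω) := by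
  have e : ∀ {ι κ : Type} [Fintype ι] [Fintype κ] (x : Vec ι) (y : Vec κ),
      (vcat x y).ofLp = Sum.elim x.ofLp y.ofLp := fun x y => rfl
  ext a
  rw [PiLp.add_apply]
  change _ = (loadW n₁ k (sqrtD d) *ᵥ _) a + (loadZ n₁ n₂ k *ᵥ _) a
  simp only [loadW, loadZ, linearNoise, e, Matrix.fromBlocks_mulVec, Matrix.fromRows_mulVec,
    Sum.elim_comp_inl, Sum.elim_comp_inr, Matrix.one_mulVec, Matrix.zero_mulVec, add_zero,
    zero_add]
  rcases a with i | l | i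
  · simp [h]
  · simp [sqrtD, Matrix.mulVec_diagonal]
  · simp

lemma IsCanonical.noises_indepFun (hY : IsCanonical d Y₁ Y₂ μ) (hV : IsG0 V 1 μ)
    (hVY : IndepFun V (fun ω => (Y₁ ω, Y₂ ω)) μ) :
    IndepFun (linearNoise d Y₁ (wStar2 d Y₁ Y₂ V)) (linearNoise d Y₂ (wStar2 d Y₁ Y₂ V)) μ :=
  (hY.isG0_noise_triple hV hVY).of_vcat_left.indepFun_of_vcat fun _ _ => rfl

lemma IsCanonical.noises_indepFun_wStar (hY : IsCanonical d Y₁ Y₂ μ) (hV : IsG0 V 1 μ)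
    (hVY : IndepFun V (fun ω => (Y₁ ω, Y₂ ω)) μ) :
    IndepFun (fun ω => (linearNoise d Y₁ (wStar2 d Y₁ Y₂ V) ω,
      linearNoise d Y₂ (wStar2 d Y₁ Y₂ V) ω)) (wStar d Y₁ Y₂ V) μ := by
  have h := (hY.isG0_noise_triple hV hVY).indepFun_of_vcat fun _ _ => rfl
  have hm : Measurable fun x : Vec ((Fin n₂ ⊕ Fin k₁) ⊕ (Fin n₂ ⊕ Fin k₂)) =>
      ((WithLp.toLp 2 fun i => x (Sum.inl i) : Vec (Fin n₂ ⊕ Fin k₁)),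
        (WithLp.toLp 2 fun i => x (Sum.inr i) : Vec (Fin n₂ ⊕ Fin k₂))) :=
    (measurable_vec fun i => measurable_vec_apply (Sum.inl i)).prodMk
      (measurable_vec fun i => measurable_vec_apply (Sum.inr i))
  exact h.comp hm measurable_id

lemma IsCanonical.isG0_linearNoise_left (hY : IsCanonical d Y₁ Y₂ μ) (hV : IsG0 V 1 μ)
    (hVY : IndepFun V (fun ω => (Y₁ ω, Y₂ ω)) μ) :
    IsG0 (linearNoise d Y₁ (wStar2 d Y₁ Y₂ V)) (qNoise k₁ d) μ := by
  have h := (hY.isG0_noise_triple hV hVY).of_vcat_left.of_vcat_left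
  rwa [Matrix.toBlocks_fromBlocks₁₁, Matrix.toBlocks_fromBlocks₁₁] at h

lemma IsCanonical.isG0_linearNoise_right (hY : IsCanonical d Y₁ Y₂ μ) (hV : IsG0 V 1 μ)
    (hVY : IndepFun V (fun ω => (Y₁ ω, Y₂ ω)) μ) :
    IsG0 (linearNoise d Y₂ (wStar2 d Y₁ Y₂ V)) (qNoise k₂ d) μ := by
  have h := (hY.isG0_noise_triple hV hVY).of_vcat_left.of_vcat_right
  rwa [Matrix.toBlocks_fromBlocks₁₁, Matrix.toBlocks_fromBlocks₂₂] at h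

lemma IsCanonical.isG0_wStar (hY : IsCanonical d Y₁ Y₂ μ) (hV : IsG0 V 1 μ)
    (hVY : IndepFun V (fun ω => (Y₁ ω, Y₂ ω)) μ) : IsG0 (wStar d Y₁ Y₂ V) 1 μ := by
  have h := (hY.isG0_noise_triple hV hVY).of_vcat_right
  rwa [Matrix.toBlocks_fromBlocks₂₂] at h

/-- `(Y₁, Y₂ | W*)` is a conditionally independent Gaussian triple. -/
lemma IsCanonical.isCIG_wStar [IsProbabilityMeasure μ] (hY : IsCanonical d Y₁ Y₂ μ)
    (hVm : Measurable V) (hV : IsG0 V 1 μ) (hVY : IndepFun V (fun ω => (Y₁ ω, Y₂ ω)) μ) :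
    IsCIG Y₁ Y₂ (wStar d Y₁ Y₂ V) μ := by
  constructor
  · let p : ∀ {ι κ : Type} [Fintype ι] [Fintype κ] (e : κ → ι), Vec ι →L[ℝ] Vec κ :=
      fun e => (PiLp.continuousLinearEquiv 2 ℝ fun _ => ℝ).symm.toContinuousLinearMap ∘L
        ContinuousLinearMap.pi fun i => EuclideanSpace.proj (𝕜 := ℝ) (e i)
    let L : Vec ((Idx n₁ n₂ k₁ ⊕ Idx n₁ n₂ k₂) ⊕ (Fin n₁ ⊕ Fin n₂)) →L[ℝ]
        (Vec (Idx n₁ n₂ k₁) × Vec (Idx n₁ n₂ k₂)) × Vec (Fin n₁ ⊕ Fin n₂) :=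
      ((p fun i => Sum.inl (Sum.inl i)).prod (p fun i => Sum.inl (Sum.inr i))).prod
        (p fun i => Sum.inr i)
    exact (hY.isG0_triple hV hVY).hasGaussianLaw.map_fun L
  · have hφ : ∀ k, Measurable fun p : Vec (Fin n₁ ⊕ Fin n₂) × Vec (Fin n₂ ⊕ Fin k) =>
        mulV (loadW n₁ k (sqrtD d)) p.1 + mulV (loadZ n₁ n₂ k) p.2 := fun k => by fun_prop
    have hW₂ := hY.measurable_wStar2 hVm
    refine isCIFun_of_indepFun (measurable_linearNoise hY.measurable_left hW₂)
      (measurable_linearNoise hY.measurable_right hW₂) (hY.measurable_wStar hVm)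
      (hY.noises_indepFun hV hVY) (hY.noises_indepFun_wStar hV hVY) (hφ k₁) (hφ k₂)
      (.of_forall fun ω => eq_loadW_add_loadZ fun i => rfl) ?_
    filter_upwards [hY.part1_ae_eq] with ω hω
    exact eq_loadW_add_loadZ fun i => (hω i).symm

/-- The conditional expectation of `X` given `W` is `A W` if `X - A W` is centred and independent of
`W`. -/
lemma condExp_ae_eq_mulV [IsProbabilityMeasure μ] {ι κ : Type} [Fintype ι] [Fintype κ]
    {X : Ω → Vec ι} {W : Ω → Vec κ} {A : Matrix ι κ ℝ} (hX : Measurable X) (hW : Measurable W)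
    (hXint : Integrable X μ) (hWint : Integrable (fun ω => mulV A (W ω)) μ)
    (hind : IndepFun (fun ω => X ω - mulV A (W ω)) W μ) (h0 : ∫ ω, (X ω - mulV A (W ω)) ∂μ = 0) :
    μ[X | sigmaOf W] =ᵐ[μ] fun ω => mulV A (W ω) := by
  have hZ : Measurable fun ω => X ω - mulV A (W ω) := hX.sub ((measurable_mulV A).comp hW)
  have h1 := condExp_indep_eq (μ := μ) hZ.comap_le hW.comap_le
    (comap_measurable fun ω => X ω - mulV A (W ω)).stronglyMeasurable hind
  have hm : StronglyMeasurable[sigmaOf W] fun ω => mulV A (W ω) :=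
    ((measurable_mulV A).comp (comap_measurable W)).stronglyMeasurable
  have h2 := condExp_of_stronglyMeasurable hW.comap_le hm hWint
  have h3 := condExp_add (hXint.sub hWint) hWint (sigmaOf W)
  rw [sub_add_cancel] at h3
  filter_upwards [h1, h3] with ω h1 h3
  have h1' : (μ[X - fun ω => mulV A (W ω) | sigmaOf W]) ω = 0 := h1.trans h0
  rw [h3, Pi.add_apply, h1', h2, zero_add]

lemma IsG0.integrable_mulV {ι κ : Type} [Fintype ι] [Fintype κ] [DecidableEq ι] [DecidableEq κ]
    {X : Ω → Vec ι} {Q : Matrix ι ι ℝ} (hX : IsG0 X Q μ) (A : Matrix κ ι ℝ) :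
    Integrable (fun ω => mulV A (X ω)) μ :=
  (hX.of_linear (Z := fun ω => mulV A (X ω)) (fun k => A k) (.of_forall fun _ _ => rfl)
    (Q' := fun k l => A k ⬝ᵥ Q *ᵥ A l) fun _ _ => rfl).hasGaussianLaw.integrable

lemma condExp_part2 [IsProbabilityMeasure μ] {k : ℕ} {Y : Ω → Vec (Idx n₁ n₂ k)}
    {W : Ω → Vec (Fin n₂)} (hY : Measurable Y) (hW : Measurable W)
    (hYint : Integrable (fun ω => part2 (Y ω)) μ)
    (hWint : Integrable (fun ω => mulV (sqrtD d) (W ω)) μ)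
    {Q : Matrix (Fin n₂ ⊕ Fin k) (Fin n₂ ⊕ Fin k) ℝ} (hZ : IsG0 (linearNoise d Y W) Q μ)
    (hind : IndepFun (linearNoise d Y W) W μ) :
    μ[fun ω => part2 (Y ω) | sigmaOf W] =ᵐ[μ] fun ω => mulV (sqrtD d) (W ω) := by
  refine condExp_ae_eq_mulV (measurable_part2.comp hY) hW hYint hWint ?_
    (IsG0.of_vcat_left hZ).integral_eq_zero
  have hm : Measurable fun x : Vec (Fin n₂ ⊕ Fin k) =>
      (WithLp.toLp 2 fun i => x (Sum.inl i) : Vec (Fin n₂)) :=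
    measurable_vec fun i => measurable_vec_apply (Sum.inl i)
  exact hind.comp hm measurable_id

lemma measurable_vec_inr {ι κ : Type} [Fintype ι] [Fintype κ] : Measurable fun x : Vec (ι ⊕ κ) =>
    (WithLp.toLp 2 fun i => x (Sum.inr i) : Vec κ) :=
  measurable_vec fun i => measurable_vec_apply (Sum.inr i)

lemma IsCanonical.condExp_part2_left [IsProbabilityMeasure μ] (hY : IsCanonical d Y₁ Y₂ μ)
    (hVm : Measurable V) (hV : IsG0 V 1 μ) (hVY : IndepFun V (fun ω => (Y₁ ω, Y₂ ω)) μ) :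
    μ[fun ω => part2 (Y₁ ω) | sigmaOf (wStar2 d Y₁ Y₂ V)] =ᵐ[μ]
      fun ω => mulV (sqrtD d) (wStar2 d Y₁ Y₂ V ω) := by
  have hS := hY.isG0_qS hV hVY
  exact condExp_part2 hY.measurable_left (hY.measurable_wStar2 hVm)
    hS.of_vcat_left.of_vcat_left.hasGaussianLaw.integrable
    (hS.of_vcat_right.integrable_mulV _) (hY.isG0_linearNoise_left hV hVY)
    ((hY.noises_indepFun_wStar hV hVY).comp measurable_fst measurable_vec_inr)

lemma IsCanonical.condExp_part2_right [IsProbabilityMeasure μ] (hY : IsCanonical d Y₁ Y₂ μ)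
    (hVm : Measurable V) (hV : IsG0 V 1 μ) (hVY : IndepFun V (fun ω => (Y₁ ω, Y₂ ω)) μ) :
    μ[fun ω => part2 (Y₂ ω) | sigmaOf (wStar2 d Y₁ Y₂ V)] =ᵐ[μ]
      fun ω => mulV (sqrtD d) (wStar2 d Y₁ Y₂ V ω) := by
  have hS := hY.isG0_qS hV hVY
  exact condExp_part2 hY.measurable_right (hY.measurable_wStar2 hVm)
    hS.of_vcat_left.of_vcat_right.hasGaussianLaw.integrable
    (hS.of_vcat_right.integrable_mulV _) (hY.isG0_linearNoise_right hV hVY)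
    ((hY.noises_indepFun_wStar hV hVY).comp measurable_snd measurable_vec_inr)

lemma noise_ae_eq_linearNoise {k : ℕ} {Y : Ω → Vec (Idx n₁ n₂ k)} {W : Ω → Vec (Fin n₂)}
    (h : μ[fun ω => part2 (Y ω) | sigmaOf W] =ᵐ[μ] fun ω => mulV (sqrtD d) (W ω)) :
    noise Y W μ =ᵐ[μ] linearNoise d Y W := by
  filter_upwards [h] with ω hω
  simp only [noise, linearNoise, hω]

lemma IsCanonical.crossCov_wStar2 (hY : IsCanonical d Y₁ Y₂ μ) (hV : IsG0 V 1 μ)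
    (hVY : IndepFun V (fun ω => (Y₁ ω, Y₂ ω)) μ) :
    crossCov (wStar2 d Y₁ Y₂ V) (wStar2 d Y₁ Y₂ V) μ = 1 := by
  ext i j
  exact ((hY.isG0_qS hV hVY).covariance (Sum.inr i) (Sum.inr j)).trans (by simp [qS])

lemma IsCanonical.regMatrix_left (hY : IsCanonical d Y₁ Y₂ μ) (hV : IsG0 V 1 μ)
    (hVY : IndepFun V (fun ω => (Y₁ ω, Y₂ ω)) μ) :
    regMatrix (fun ω => part2 (Y₁ ω)) (wStar2 d Y₁ Y₂ V) μ = sqrtD d := by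
  rw [regMatrix, hY.crossCov_wStar2 hV hVY, inv_one, mul_one]
  ext i j
  exact ((hY.isG0_qS hV hVY).covariance (Sum.inl (Sum.inl i)) (Sum.inr j)).trans (by simp [qS])

lemma IsCanonical.regMatrix_right (hY : IsCanonical d Y₁ Y₂ μ) (hV : IsG0 V 1 μ)
    (hVY : IndepFun V (fun ω => (Y₁ ω, Y₂ ω)) μ) :
    regMatrix (fun ω => part2 (Y₂ ω)) (wStar2 d Y₁ Y₂ V) μ = sqrtD d := by
  rw [regMatrix, hY.crossCov_wStar2 hV hVY, inv_one, mul_one]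
  ext i j
  exact ((hY.isG0_qS hV hVY).covariance (Sum.inl (Sum.inr i)) (Sum.inr j)).trans (by simp [qS])

end Realization

/-! ### The lower bound for an arbitrary common variable -/

/-- If `W` makes `Y₁` and `Y₂` conditionally independent, and if these have pairs of components with
correlations `ρ j` and uncorrelated otherwise, then the normalized sums of the pairs are estimated
from `W` with mean square errors at most `(1 - ρ j) / (1 + ρ j)`. -/
lemma IsCIFun.ofReal_sum_log_le_mutualInfo {Ω 𝕎 : Type*} [MeasurableSpace Ω] [MeasurableSpace 𝕎]
    {μ : Measure Ω} [IsProbabilityMeasure μ] {ι κ J : Type} [Fintype ι] [Fintype κ] [Fintype J]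
    [DecidableEq ι] [DecidableEq κ] [DecidableEq J] {Y₁ : Ω → Vec ι} {Y₂ : Ω → Vec κ} {W : Ω → 𝕎}
    (hCI : IsCIFun Y₁ Y₂ W μ) (h₁ : Measurable Y₁) (h₂ : Measurable Y₂) (hW : Measurable W)
    {Q : Matrix (ι ⊕ κ) (ι ⊕ κ) ℝ} (hQ : IsG0 (fun ω => vcat (Y₁ ω) (Y₂ ω)) Q μ)
    (a : J → ι) (b : J → κ) {ρ : J → ℝ} (hρ : ∀ j, 0 < ρ j)
    (hQ₁₁ : ∀ i j, Q (Sum.inl (a i)) (Sum.inl (a j)) = if i = j then 1 else 0)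
    (hQ₂₂ : ∀ i j, Q (Sum.inr (b i)) (Sum.inr (b j)) = if i = j then 1 else 0)
    (hQ₁₂ : ∀ i j, Q (Sum.inl (a i)) (Sum.inr (b j)) = if i = j then ρ i else 0)
    {r : J → ℝ} (hr : ∀ j, 0 < r j) (hle : ∀ j, (1 - ρ j) / (1 + ρ j) ≤ r j) :
    ENNReal.ofReal (∑ j, -(1 / 2) * Real.log (r j)) ≤
      mutualInfo (fun ω => (Y₁ ω, Y₂ ω)) W μ := by
  have hQ₂₁ : ∀ i j, Q (Sum.inr (b i)) (Sum.inl (a j)) = if i = j then ρ i else 0 := by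
    intro i j
    have h := hQ.1.isHermitian.apply (Sum.inl (a j)) (Sum.inr (b i))
    simp only [star_trivial] at h
    rw [h, hQ₁₂]
    by_cases hij : i = j
    · simp [hij]
    · simp [hij, Ne.symm hij]
  -- `2 (1 + ρ j)` is the variance of the sum of the `j`-th pair
  have hρ' : ∀ j, 0 < 2 * (1 + ρ j) := fun j => by linarith [hρ j]
  set c : J → ℝ := fun j => 1 / √(2 * (1 + ρ j)) with hc
  have hc2 : ∀ j, c j * c j * (2 * (1 + ρ j)) = 1 := by
    intro j
    have := (hρ' j).ne'
    simp only [hc]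
    rw [div_mul_div_comm, Real.mul_self_sqrt (hρ' j).le, one_mul, one_div_mul_cancel this]
  set x : J → Vec ι × Vec κ → ℝ := fun j y => c j * (y.1 (a j) + y.2 (b j)) with hx
  have hxm : ∀ j, Measurable (x j) := fun j => by simp only [hx]; fun_prop
  have hm₁ : ∀ j, MemLp (fun ω => Y₁ ω (a j)) 2 μ := fun j => hQ.memLp_apply (Sum.inl (a j))
  have hm₂ : ∀ j, MemLp (fun ω => Y₂ ω (b j)) 2 μ := fun j => hQ.memLp_apply (Sum.inr (b j))
  have hlaw : IsG0 (fun ω => (WithLp.toLp 2 fun j => x j (Y₁ ω, Y₂ ω) : Vec J)) 1 μ := by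
    refine hQ.of_linear (fun j => c j • (Pi.single (Sum.inl (a j)) 1 + Pi.single (Sum.inr (b j)) 1))
      (.of_forall fun ω j => by simp [hx, add_dotProduct, mul_add]) fun i j => ?_
    simp only [smul_dotProduct, add_dotProduct, single_one_dotProduct, Matrix.mulVec_smul,
      Matrix.mulVec_add, Matrix.mulVec_single_one, Pi.smul_apply, Pi.add_apply, Matrix.col_apply,
      smul_eq_mul, hQ₁₁, hQ₁₂, hQ₂₁, hQ₂₂, Matrix.one_apply]
    split_ifs with h
    · subst h
      linarith [hc2 i]
    · simp
  -- the conditional expectation of the sum of a pair, as a function of `W`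
  have hex : ∀ j, ∃ h : 𝕎 → ℝ, Measurable h ∧
      μ[(fun ω => Y₁ ω (a j)) + fun ω => Y₂ ω (b j) | sigmaOf W] = h ∘ W := fun j =>
    (stronglyMeasurable_condExp (m := sigmaOf W)).measurable.exists_eq_measurable_comp
  choose h hhm hh using hex
  have hsq : ∀ j, Integrable
      (fun ω => (Y₁ ω (a j) + Y₂ ω (b j) - h j (W ω)) ^ 2) μ := by
    intro j
    have h3 := ((hm₁ j).add (hm₂ j)).sub
      (((hm₁ j).add (hm₂ j)).condExp (m := sigmaOf W) one_le_two)
    rw [hh] at h3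
    exact h3.integrable_sq
  have hsqle : ∀ j, ∫ ω, (Y₁ ω (a j) + Y₂ ω (b j) - h j (W ω)) ^ 2 ∂μ ≤ 2 * (1 - ρ j) := by
    intro j
    have h4 := IsCI.integral_sq_residual_add_le h₁.comap_le h₂.comap_le hW.comap_le hCI
      ((measurable_vec_apply (a j)).comp (comap_measurable Y₁)).stronglyMeasurable
      ((measurable_vec_apply (b j)).comp (comap_measurable Y₂)).stronglyMeasurable
      (hm₁ j) (hm₂ j)
    have h5 : ∫ ω, (Y₁ ω (a j) - Y₂ ω (b j)) ^ 2 ∂μ = 2 * (1 - ρ j) := by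
      have e : ∀ ω, (Y₁ ω (a j) - Y₂ ω (b j)) ^ 2 = Y₁ ω (a j) * Y₁ ω (a j)
          - 2 * (Y₁ ω (a j) * Y₂ ω (b j)) + Y₂ ω (b j) * Y₂ ω (b j) := fun ω => by ring
      have i₁ : Integrable (fun ω => Y₁ ω (a j) * Y₁ ω (a j)) μ := (hm₁ j).integrable_mul (hm₁ j)
      have i₂ : Integrable (fun ω => Y₁ ω (a j) * Y₂ ω (b j)) μ := (hm₁ j).integrable_mul (hm₂ j)
      have i₃ : Integrable (fun ω => Y₂ ω (b j) * Y₂ ω (b j)) μ := (hm₂ j).integrable_mul (hm₂ j)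
      have i₄ : Integrable (fun ω => Y₁ ω (a j) * Y₁ ω (a j)
          - 2 * (Y₁ ω (a j) * Y₂ ω (b j))) μ := i₁.sub (i₂.const_mul 2)
      have e₁ := hQ.integral_mul (Sum.inl (a j)) (Sum.inl (a j))
      have e₂ := hQ.integral_mul (Sum.inl (a j)) (Sum.inr (b j))
      have e₃ := hQ.integral_mul (Sum.inr (b j)) (Sum.inr (b j))
      simp only [vcat_inl, vcat_inr, hQ₁₁, hQ₁₂, hQ₂₂, if_true] at e₁ e₂ e₃
      simp only [e]
      rw [integral_add i₄ i₃, integral_sub i₁ (i₂.const_mul 2), integral_const_mul, e₁, e₂, e₃]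
      ring
    refine le_trans (le_of_eq ?_) (h4.trans_eq h5)
    refine integral_congr_ae (.of_forall fun ω => ?_)
    change _ = (Y₁ ω (a j) + Y₂ ω (b j) -
      (μ[(fun ω => Y₁ ω (a j)) + fun ω => Y₂ ω (b j) | sigmaOf W]) ω) ^ 2
    rw [hh j]
    rfl
  have e : ∀ j ω, (x j (Y₁ ω, Y₂ ω) - c j * h j (W ω)) ^ 2 =
      c j * c j * (Y₁ ω (a j) + Y₂ ω (b j) - h j (W ω)) ^ 2 := fun j ω => by
    simp only [hx]; ring
  refine _root_.ofReal_sum_log_le_mutualInfo (h₁.prodMk h₂) hW hxm hlaw.hasLaw_pi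
    (f := fun j w => c j * h j w) (fun j => (hhm j).const_mul _) hr (fun j => ?_) fun j => ?_
  · simp only [e]
    exact (hsq j).const_mul _
  · simp only [e]
    rw [integral_const_mul]
    have hcc : c j * c j = 1 / (2 * (1 + ρ j)) := by
      rw [eq_div_iff (hρ' j).ne']
      exact hc2 j
    refine le_trans ?_ (hle j)
    calc c j * c j * ∫ ω, (Y₁ ω (a j) + Y₂ ω (b j) - h j (W ω)) ^ 2 ∂μ
        ≤ c j * c j * (2 * (1 - ρ j)) :=
          mul_le_mul_of_nonneg_left (hsqle j) (mul_self_nonneg _)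
      _ = (1 - ρ j) / (1 + ρ j) := by
          rw [hcc]
          have : 1 + ρ j ≠ 0 := by linarith [hρ j]
          field_simp

section CanonicalLowerBound

variable {Ω : Type*} [MeasurableSpace Ω] {μ : Measure Ω} {n₁ n₂ k₁ k₂ : ℕ} {d : Fin n₂ → ℝ}
  {Y₁ : Ω → Vec (Idx n₁ n₂ k₁)} {Y₂ : Ω → Vec (Idx n₁ n₂ k₂)}

lemma neg_half_mul_log_div {t : ℝ} :
    -(1 / 2) * Real.log ((1 - t) / (1 + t)) = 1 / 2 * Real.log ((1 + t) / (1 - t)) := by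
  rw [← inv_div (1 + t), Real.log_inv]
  ring

lemma IsCanonical.le_mutualInfo [IsProbabilityMeasure μ] (hY : IsCanonical d Y₁ Y₂ μ) {𝕎 : Type*}
    [MeasurableSpace 𝕎] {W : Ω → 𝕎} (hW : Measurable W) (hCI : IsCIFun Y₁ Y₂ W μ) :
    ENNReal.ofReal (1 / 2 * ∑ i, Real.log ((1 + d i) / (1 - d i))) ≤
      mutualInfo (fun ω => (Y₁ ω, Y₂ ω)) W μ := by
  have h := hCI.ofReal_sum_log_le_mutualInfo hY.measurable_left hY.measurable_right hW hY.law
    (fun l : Fin n₂ => Sum.inr (Sum.inl l)) (fun l => Sum.inr (Sum.inl l)) hY.pos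
    (fun i j => by simp [qCvf, Matrix.one_apply]) (fun i j => by simp [qCvf, Matrix.one_apply])
    (fun i j => by simp [qCvf, cvfCross, Matrix.diagonal_apply])
    (r := fun i => (1 - d i) / (1 + d i))
    (fun i => div_pos (by linarith [hY.lt_one i]) (by linarith [hY.pos i])) fun i => le_rfl
  simpa only [neg_half_mul_log_div, ← Finset.mul_sum] using h

/-- A common component of positive variance makes the mutual information infinite: it is estimated
without error from `W`. -/
lemma IsCanonical.mutualInfo_eq_top [IsProbabilityMeasure μ] (hY : IsCanonical d Y₁ Y₂ μ)
    {𝕎 : Type*} [MeasurableSpace 𝕎] {W : Ω → 𝕎} (hW : Measurable W) (hCI : IsCIFun Y₁ Y₂ W μ)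
    (hn : 0 < n₁) : mutualInfo (fun ω => (Y₁ ω, Y₂ ω)) W μ = ⊤ := by
  refine ENNReal.eq_top_of_forall_nnreal_le fun M => ?_
  -- a single pair with `ρ = 1`; the error bound `r = exp (-2 M)` gives `-(1 / 2) * log r = M`
  have h := hCI.ofReal_sum_log_le_mutualInfo hY.measurable_left hY.measurable_right hW hY.law
    (fun _ : Unit => Sum.inl ⟨0, hn⟩) (fun _ => Sum.inl ⟨0, hn⟩) (ρ := fun _ => 1)
    (fun _ => one_pos) (fun _ _ => by simp [qCvf]) (fun _ _ => by simp [qCvf])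
    (fun _ _ => by simp [qCvf, cvfCross]) (r := fun _ => Real.exp (-2 * M))
    (fun _ => Real.exp_pos _) fun _ => by
      rw [sub_self, zero_div]; exact (Real.exp_pos _).le
  refine le_trans (le_of_eq ?_) h
  rw [Fintype.sum_unique, Real.log_exp]
  rw [show -(1 / 2) * (-2 * (M : ℝ)) = M by ring, ENNReal.ofReal_coe_nnreal]

lemma IsCanonical.of_map_eq {Ω' : Type*} [MeasurableSpace Ω'] {μ' : Measure Ω'}
    (hY : IsCanonical d Y₁ Y₂ μ) {Y₁' : Ω' → Vec (Idx n₁ n₂ k₁)} {Y₂' : Ω' → Vec (Idx n₁ n₂ k₂)}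
    (h₁ : Measurable Y₁') (h₂ : Measurable Y₂')
    (h : μ'.map (fun ω => (Y₁' ω, Y₂' ω)) = μ.map fun ω => (Y₁ ω, Y₂ ω)) :
    IsCanonical d Y₁' Y₂' μ' := by
  refine ⟨h₁, h₂, hY.pos, hY.lt_one, hY.antitone, hY.law.1,
    (measurable_vcat.comp (h₁.prodMk h₂)).aemeasurable, ?_⟩
  have e := hY.law.2.map_eq
  have e1 := Measure.map_map (μ := μ) (measurable_vcat (ι := Idx n₁ n₂ k₁) (κ := Idx n₁ n₂ k₂))
    (hY.measurable_left.prodMk hY.measurable_right)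
  have e2 := Measure.map_map (μ := μ') (measurable_vcat (ι := Idx n₁ n₂ k₁) (κ := Idx n₁ n₂ k₂))
    (h₁.prodMk h₂)
  rw [h, e1] at e2
  exact e2.symm.trans e

end CanonicalLowerBound

/-! ### Invariance of the common information under linear isomorphisms -/

section Invariance

lemma IsCIFun.comp {Ω α β γ α' β' γ' : Type*} [MeasurableSpace Ω] [MeasurableSpace α]
    [MeasurableSpace β] [MeasurableSpace γ] [MeasurableSpace α'] [MeasurableSpace β']
    [MeasurableSpace γ'] {μ : Measure Ω} {Y₁ : Ω → α} {Y₂ : Ω → β} {W : Ω → γ}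
    (h : IsCIFun Y₁ Y₂ W μ) {f : α → α'} {g : β → β'} (hf : Measurable f) (hg : Measurable g)
    {T : γ → γ'} (hT : MeasurableEmbedding T) :
    IsCIFun (fun ω => f (Y₁ ω)) (fun ω => g (Y₂ ω)) (fun ω => T (W ω)) μ := by
  have e : sigmaOf (fun ω => T (W ω)) = sigmaOf W := by
    change MeasurableSpace.comap (T ∘ W) _ = _
    rw [← MeasurableSpace.comap_comp, hT.comap_eq]
  intro s t hs ht
  rw [e]
  exact h s t ((hf.comp (comap_measurable Y₁)).comap_le s hs)
    ((hg.comp (comap_measurable Y₂)).comap_le t ht)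

variable {Ω : Type*} [MeasurableSpace Ω] {μ : Measure Ω} {ι κ τ ι' κ' τ' : Type} [Fintype ι]
  [Fintype κ] [Fintype τ] [Fintype ι'] [Fintype κ'] [Fintype τ'] {Y₁ : Ω → Vec ι}
  {Y₂ : Ω → Vec κ} {W : Ω → Vec τ}

lemma IsCIG.comp (h : IsCIG Y₁ Y₂ W μ) (S₁ : Vec ι ≃L[ℝ] Vec ι') (S₂ : Vec κ ≃L[ℝ] Vec κ')
    (T : Vec τ ≃L[ℝ] Vec τ') :
    IsCIG (fun ω => S₁ (Y₁ ω)) (fun ω => S₂ (Y₂ ω)) (fun ω => T (W ω)) μ :=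
  ⟨h.1.map_equiv_fun ((S₁.prodCongr S₂).prodCongr T),
    h.2.comp S₁.continuous.measurable S₂.continuous.measurable
      T.toHomeomorph.measurableEmbedding⟩

lemma IsCIG.map_mem_cigLaws [IsProbabilityMeasure μ] (h : IsCIG Y₁ Y₂ W μ) (h₁ : Measurable Y₁)
    (h₂ : Measurable Y₂) (hW : Measurable W) :
    μ.map (fun ω => ((Y₁ ω, Y₂ ω), W ω)) ∈ cigLaws (μ.map fun ω => (Y₁ ω, Y₂ ω)) τ := by
  have hm : Measurable fun ω => ((Y₁ ω, Y₂ ω), W ω) := (h₁.prodMk h₂).prodMk hW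
  refine ⟨?_, ⟨?_⟩, ?_⟩
  · rw [Measure.fst, Measure.map_map measurable_fst hm]
    rfl
  · have e : (fun z : (Vec ι × Vec κ) × Vec τ => ((z.1.1, z.1.2), z.2)) = id := rfl
    rw [e, Measure.map_id]
    exact h.1.isGaussian_map
  · rw [isCIFun_map_iff hm (by fun_prop) (by fun_prop) (by fun_prop)]
    exact h.2

/-- The infimum extends over `W` with index sets `Fin k` only, but every finite index set can be
enumerated. -/
lemma IsCIG.wynerCI_le [IsProbabilityMeasure μ] (h : IsCIG Y₁ Y₂ W μ) (h₁ : Measurable Y₁)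
    (h₂ : Measurable Y₂) (hW : Measurable W) :
    wynerCI Y₁ Y₂ μ ≤ mutualInfo (fun ω => (Y₁ ω, Y₂ ω)) W μ := by
  let T : Vec τ ≃L[ℝ] Vec (Fin (Fintype.card τ)) :=
    (LinearIsometryEquiv.piLpCongrLeft 2 ℝ ℝ (Fintype.equivFin τ)).toContinuousLinearEquiv
  have hT : Measurable T := T.continuous.measurable
  have hTW : Measurable fun ω => T (W ω) := hT.comp hW
  have h' : IsCIG Y₁ Y₂ (fun ω => T (W ω)) μ := h.comp (.refl ℝ _) (.refl ℝ _) T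
  have hmem := h'.map_mem_cigLaws h₁ h₂ hTW
  refine (iInf₂_le_of_le _ _ (iInf_le _ hmem)).trans ?_
  rw [mutualInfo_map ((h₁.prodMk h₂).prodMk hTW) measurable_fst measurable_snd]
  exact mutualInfo_comp_le (h₁.prodMk h₂) hW measurable_id hT

lemma isProbabilityMeasure_of_fst_eq {α β : Type*} [MeasurableSpace α] [MeasurableSpace β]
    {P : Measure α} [IsProbabilityMeasure P] {Q : Measure (α × β)} (h : Q.fst = P) :
    IsProbabilityMeasure Q :=
  ⟨by rw [← Measure.fst_univ, h, measure_univ]⟩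

lemma commonInfo_map_le (P : Measure (Vec ι × Vec κ)) [IsProbabilityMeasure P]
    (S₁ : Vec ι ≃L[ℝ] Vec ι') (S₂ : Vec κ ≃L[ℝ] Vec κ') :
    commonInfo (P.map (Prod.map S₁ S₂)) ≤ commonInfo P := by
  have m₁ : Measurable S₁ := S₁.continuous.measurable
  have m₂ : Measurable S₂ := S₂.continuous.measurable
  refine le_iInf fun k => le_iInf₂ fun Q hQ => ?_
  have := isProbabilityMeasure_of_fst_eq hQ.1
  have h := (hQ.2.comp S₁ S₂ (.refl ℝ _)).wynerCI_le (m₁.comp (by fun_prop))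
    (m₂.comp (by fun_prop)) measurable_snd
  have e : Q.map (fun z => (S₁ z.1.1, S₂ z.1.2)) = P.map (Prod.map S₁ S₂) := by
    rw [← hQ.1, Measure.fst, Measure.map_map (m₁.prodMap m₂) measurable_fst]
    rfl
  rw [wynerCI, e] at h
  exact h.trans (mutualInfo_comp_le measurable_fst measurable_snd (m₁.prodMap m₂) measurable_id)

lemma IsCIFun.wynerCIArb_le {𝕎 : Type} [MeasurableSpace 𝕎] {W : Ω → 𝕎} [IsProbabilityMeasure μ]
    (h : IsCIFun Y₁ Y₂ W μ) (h₁ : Measurable Y₁) (h₂ : Measurable Y₂) (hW : Measurable W) :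
    wynerCIArb Y₁ Y₂ μ ≤ mutualInfo (fun ω => (Y₁ ω, Y₂ ω)) W μ := by
  have hm : Measurable fun ω => ((Y₁ ω, Y₂ ω), W ω) := (h₁.prodMk h₂).prodMk hW
  have e : (μ.map fun ω => ((Y₁ ω, Y₂ ω), W ω)).fst = μ.map fun ω => (Y₁ ω, Y₂ ω) := by
    rw [Measure.fst, Measure.map_map measurable_fst hm]
    rfl
  have hCI := (isCIFun_map_iff (μ := μ) hm (Y₁ := fun z : (Vec ι × Vec κ) × 𝕎 => z.1.1)
    (Y₂ := fun z => z.1.2) (W := fun z => z.2) (by fun_prop) (by fun_prop) (by fun_prop)).2 h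
  have hle : wynerCIArb Y₁ Y₂ μ ≤ mutualInfo (fun z : (Vec ι × Vec κ) × 𝕎 => z.1)
      (fun z => z.2) (μ.map fun ω => ((Y₁ ω, Y₂ ω), W ω)) :=
    iInf_le_of_le 𝕎 <| iInf_le_of_le _ <| iInf_le_of_le _ <| iInf_le_of_le e <| iInf_le _ hCI
  rwa [mutualInfo_map hm measurable_fst measurable_snd] at hle

lemma commonInfoArb_map_le (P : Measure (Vec ι × Vec κ)) [IsProbabilityMeasure P]
    (S₁ : Vec ι ≃L[ℝ] Vec ι') (S₂ : Vec κ ≃L[ℝ] Vec κ') :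
    commonInfoArb (P.map (Prod.map S₁ S₂)) ≤ commonInfoArb P := by
  have m₁ : Measurable S₁ := S₁.continuous.measurable
  have m₂ : Measurable S₂ := S₂.continuous.measurable
  refine le_iInf fun 𝕎 => le_iInf fun _ => le_iInf fun Q => le_iInf₂ fun hQ hCI => ?_
  have := isProbabilityMeasure_of_fst_eq hQ
  have h := (hCI.comp m₁ m₂ MeasurableEmbedding.id).wynerCIArb_le (m₁.comp (by fun_prop))
    (m₂.comp (by fun_prop)) measurable_snd
  have e : Q.map (fun z => (S₁ z.1.1, S₂ z.1.2)) = P.map (Prod.map S₁ S₂) := by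
    rw [← hQ, Measure.fst, Measure.map_map (m₁.prodMap m₂) measurable_fst]
    rfl
  rw [wynerCIArb, e] at h
  exact h.trans (mutualInfo_comp_le measurable_fst measurable_snd (m₁.prodMap m₂) measurable_id)

lemma map_symm_map (P : Measure (Vec ι × Vec κ)) (S₁ : Vec ι ≃L[ℝ] Vec ι')
    (S₂ : Vec κ ≃L[ℝ] Vec κ') :
    (P.map (Prod.map S₁ S₂)).map (Prod.map S₁.symm S₂.symm) = P := by
  rw [Measure.map_map (S₁.symm.continuous.measurable.prodMap S₂.symm.continuous.measurable)
    (S₁.continuous.measurable.prodMap S₂.continuous.measurable), Prod.map_comp_map]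
  simp

/-- The common information depends on `Y₁` and `Y₂` only up to linear isomorphisms, for both
versions of the infimum. -/
lemma wynerCI_comp_equiv [IsProbabilityMeasure μ] (h₁ : Measurable Y₁) (h₂ : Measurable Y₂)
    (S₁ : Vec ι ≃L[ℝ] Vec ι') (S₂ : Vec κ ≃L[ℝ] Vec κ') :
    wynerCI (fun ω => S₁ (Y₁ ω)) (fun ω => S₂ (Y₂ ω)) μ = wynerCI Y₁ Y₂ μ ∧
      wynerCIArb (fun ω => S₁ (Y₁ ω)) (fun ω => S₂ (Y₂ ω)) μ = wynerCIArb Y₁ Y₂ μ := by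
  have m₁ : Measurable S₁ := S₁.continuous.measurable
  have m₂ : Measurable S₂ := S₂.continuous.measurable
  have := Measure.isProbabilityMeasure_map (μ := μ) (h₁.prodMk h₂).aemeasurable
  have e : μ.map (fun ω => (S₁ (Y₁ ω), S₂ (Y₂ ω))) =
      (μ.map fun ω => (Y₁ ω, Y₂ ω)).map (Prod.map S₁ S₂) := by
    rw [Measure.map_map (m₁.prodMap m₂) (h₁.prodMk h₂)]
    rfl
  have := Measure.isProbabilityMeasure_map (μ := μ.map fun ω => (Y₁ ω, Y₂ ω))
    (m₁.prodMap m₂).aemeasurable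
  simp only [wynerCI, wynerCIArb, e]
  refine ⟨(commonInfo_map_le _ S₁ S₂).antisymm ?_, (commonInfoArb_map_le _ S₁ S₂).antisymm ?_⟩
  · have h := commonInfo_map_le ((μ.map fun ω => (Y₁ ω, Y₂ ω)).map (Prod.map S₁ S₂)) S₁.symm S₂.symm
    rwa [map_symm_map] at h
  · have h := commonInfoArb_map_le ((μ.map fun ω => (Y₁ ω, Y₂ ω)).map (Prod.map S₁ S₂))
      S₁.symm S₂.symm
    rwa [map_symm_map] at h

/-- Gaussian common variables are among the arbitrary ones. -/
lemma wynerCIArb_le_wynerCI : wynerCIArb Y₁ Y₂ μ ≤ wynerCI Y₁ Y₂ μ :=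
  le_iInf fun _ => le_iInf₂ fun Q hQ =>
    iInf_le_of_le _ <| iInf_le_of_le _ <| iInf_le_of_le Q <| iInf₂_le hQ.1 hQ.2.2

end Invariance

/-! ### The value of the common information -/

section Value

variable {Ω : Type*} [MeasurableSpace Ω] {μ : Measure Ω} [IsProbabilityMeasure μ]
  {n₁ n₂ k₁ k₂ : ℕ} {d : Fin n₂ → ℝ}
  {Y₁ : Ω → Vec (Idx n₁ n₂ k₁)} {Y₂ : Ω → Vec (Idx n₁ n₂ k₂)} {V : Ω → Vec (Fin n₂)}

/-- The value of the common information of a pair in canonical variable form. -/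
noncomputable def cvfValue (n₁ : ℕ) (d : Fin n₂ → ℝ) : ℝ≥0∞ :=
  if n₁ = 0 then ENNReal.ofReal (1 / 2 * ∑ i, Real.log ((1 + d i) / (1 - d i))) else ⊤

lemma IsCanonical.cvfValue_le_mutualInfo (hY : IsCanonical d Y₁ Y₂ μ) {𝕎 : Type*}
    [MeasurableSpace 𝕎] {W : Ω → 𝕎} (hW : Measurable W) (hCI : IsCIFun Y₁ Y₂ W μ) :
    cvfValue n₁ d ≤ mutualInfo (fun ω => (Y₁ ω, Y₂ ω)) W μ := by
  unfold cvfValue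
  split_ifs with h
  · exact hY.le_mutualInfo hW hCI
  · exact (hY.mutualInfo_eq_top hW hCI (Nat.pos_of_ne_zero h)).ge

lemma IsCanonical.cvfValue_le_wynerCIArb (hY : IsCanonical d Y₁ Y₂ μ) :
    cvfValue n₁ d ≤ wynerCIArb Y₁ Y₂ μ := by
  have := Measure.isProbabilityMeasure_map (μ := μ)
    (hY.measurable_left.prodMk hY.measurable_right).aemeasurable
  refine le_iInf fun 𝕎 => le_iInf fun _ => le_iInf fun Q => le_iInf₂ fun hQ hCI => ?_
  have := isProbabilityMeasure_of_fst_eq hQ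
  have hY' : IsCanonical d (fun z : (Vec (Idx n₁ n₂ k₁) × Vec (Idx n₁ n₂ k₂)) × 𝕎 => z.1.1)
      (fun z => z.1.2) Q := hY.of_map_eq (by fun_prop) (by fun_prop) hQ
  exact hY'.cvfValue_le_mutualInfo measurable_snd hCI

/-- `W*` attains the lower bound. If there is no identical part, then `(Y₁, Y₂) ↦ W*` is an additive
Gaussian channel with noise variances `(1 - d i) / (1 + d i)`. -/
lemma IsCanonical.mutualInfo_wStar (hY : IsCanonical d Y₁ Y₂ μ) (hVm : Measurable V)
    (hV : IsG0 V 1 μ) (hVY : IndepFun V (fun ω => (Y₁ ω, Y₂ ω)) μ) :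
    mutualInfo (fun ω => (Y₁ ω, Y₂ ω)) (wStar d Y₁ Y₂ V) μ = cvfValue n₁ d := by
  refine le_antisymm ?_
    (hY.cvfValue_le_mutualInfo (hY.measurable_wStar hVm) (hY.isCIG_wStar hVm hV hVY).2)
  unfold cvfValue
  split_ifs with h
  swap
  · exact le_top
  subst h
  have hofLp := WithLp.measurable_ofLp 2 (Fin n₂ → ℝ)
  have hV1 : IsG0 (wStar2 d Y₁ Y₂ V) 1 μ := by
    have h := (hY.isG0_qS hV hVY).of_vcat_right
    rwa [qS, Matrix.toBlocks_fromBlocks₂₂] at h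
  have hb : ∀ l, 0 < √(1 - d l) / √(1 + d l) := fun l =>
    div_pos (Real.sqrt_pos.2 (by linarith [hY.lt_one l])) (Real.sqrt_pos.2 (by linarith [hY.pos l]))
  have h1 := mutualInfo_gaussianChannel (μ := μ) (J := Fin n₂) (Y := fun ω => (Y₁ ω, Y₂ ω))
    (V := fun ω => (V ω).ofLp) (W := fun ω => (wStar2 d Y₁ Y₂ V ω).ofLp)
    (hY.measurable_left.prodMk hY.measurable_right) (hofLp.comp hVm)
    (hVY.symm.comp measurable_id hofLp) hV.hasLaw_pi hV1.hasLaw_pi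
    (c := fun l y => √(d l) / (1 + d l) * y.1 (Sum.inr (Sum.inl l))
      + √(d l) / (1 + d l) * y.2 (Sum.inr (Sum.inl l)))
    (fun l => by fun_prop) hb (fun ω l => wStar2_apply ω l)
  have h2 : ∀ l, (√(1 - d l) / √(1 + d l)) ^ 2 = (1 - d l) / (1 + d l) := fun l => by
    rw [div_pow, Real.sq_sqrt (by linarith [hY.lt_one l]), Real.sq_sqrt (by linarith [hY.pos l])]
  simp only [h2, neg_half_mul_log_div, ← Finset.mul_sum] at h1
  rw [← h1]
  have hg : Measurable fun w : Fin n₂ → ℝ =>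
      vcat (0 : Vec (Fin 0)) (WithLp.toLp 2 w : Vec (Fin n₂)) :=
    measurable_vcat.comp (measurable_const.prodMk (WithLp.measurable_toLp 2 _))
  have h3 := mutualInfo_comp_le (μ := μ) (hY.measurable_left.prodMk hY.measurable_right)
    (hofLp.comp (hY.measurable_wStar2 hVm)) measurable_id hg
  -- for `n₁ = 0`, `W*` is `W₂*` with an empty first block
  have h4 : wStar d Y₁ Y₂ V = fun ω =>
      vcat (0 : Vec (Fin 0)) (WithLp.toLp 2 (wStar2 d Y₁ Y₂ V ω).ofLp : Vec (Fin n₂)) := by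
    ext ω a
    rcases a with a | a
    · exact a.elim0
    · rfl
  rw [h4]
  exact h3

/-- The common information, and a jointly Gaussian law by which it is attained. The variable `V` is
constructed on a product space. -/
lemma IsCanonical.exists_wynerCI_eq (hY : IsCanonical d Y₁ Y₂ μ) :
    wynerCI Y₁ Y₂ μ = cvfValue n₁ d ∧ wynerCIArb Y₁ Y₂ μ = cvfValue n₁ d ∧
      ∃ Q ∈ cigLaws (μ.map fun ω => (Y₁ ω, Y₂ ω)) (Fin n₁ ⊕ Fin n₂),
        mutualInfo (fun z => z.1) (fun z => z.2) Q = cvfValue n₁ d := by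
  set ν : Measure (Vec (Fin n₂)) := multivariateGaussian 0 1 with hν
  have h₁ := hY.measurable_left
  have h₂ := hY.measurable_right
  have hlaw : (μ.prod ν).map (fun z => (Y₁ z.1, Y₂ z.1)) = μ.map fun ω => (Y₁ ω, Y₂ ω) := by
    have e := Measure.map_map (μ := μ.prod ν) (h₁.prodMk h₂) measurable_fst
    rw [(measurePreserving_fst (μ := μ) (ν := ν)).map_eq] at e
    exact e.symm
  have hY' : IsCanonical d (fun z : Ω × Vec (Fin n₂) => Y₁ z.1) (fun z => Y₂ z.1) (μ.prod ν) :=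
    hY.of_map_eq (h₁.comp measurable_fst) (h₂.comp measurable_fst) hlaw
  have hV : IsG0 (fun z : Ω × Vec (Fin n₂) => z.2) 1 (μ.prod ν) :=
    ⟨Matrix.PosSemidef.one, (measurePreserving_snd (μ := μ) (ν := ν)).hasLaw⟩
  have hVY : IndepFun (fun z : Ω × Vec (Fin n₂) => z.2) (fun z => (Y₁ z.1, Y₂ z.1)) (μ.prod ν) :=
    (indepFun_prod (h₁.prodMk h₂) measurable_id).symm
  have hm := hY'.measurable_wStar measurable_snd
  have hG := hY'.isCIG_wStar measurable_snd hV hVY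
  have hI := hY'.mutualInfo_wStar measurable_snd hV hVY
  have hle := hG.wynerCI_le hY'.measurable_left hY'.measurable_right hm
  have hmem := hG.map_mem_cigLaws hY'.measurable_left hY'.measurable_right hm
  rw [hlaw] at hmem
  rw [hI, wynerCI, hlaw] at hle
  refine ⟨hle.antisymm (hY.cvfValue_le_wynerCIArb.trans wynerCIArb_le_wynerCI),
    (wynerCIArb_le_wynerCI.trans hle).antisymm hY.cvfValue_le_wynerCIArb, _, hmem, ?_⟩
  rw [mutualInfo_map ((hY'.measurable_left.prodMk hY'.measurable_right).prodMk hm) measurable_fst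
    measurable_snd]
  exact hI

end Value

/-! ### The parts of a pair in canonical variable form -/

section Parts

variable {Ω : Type*} [MeasurableSpace Ω] {μ : Measure Ω} [IsProbabilityMeasure μ]
  {n₁ n₂ k₁ k₂ : ℕ} {d : Fin n₂ → ℝ}
  {Y₁ : Ω → Vec (Idx n₁ n₂ k₁)} {Y₂ : Ω → Vec (Idx n₁ n₂ k₂)}

/-- The common information of two vectors `X₁`, `X₂` which consist, up to the enumerations `e₁`,
`e₂`, of the components `f₁`, `f₂` of `Y₁`, `Y₂`, and which are in canonical variable form. -/
lemma IsCanonical.wynerCI_subvector (hY : IsCanonical d Y₁ Y₂ μ) {m₁ m₂ l₁ l₂ : ℕ} {ι κ : Type}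
    [Fintype ι] [Fintype κ] {X₁ : Ω → Vec ι} {X₂ : Ω → Vec κ} (h₁ : Measurable X₁)
    (h₂ : Measurable X₂) (e₁ : Idx m₁ m₂ l₁ ≃ ι) (e₂ : Idx m₁ m₂ l₂ ≃ κ)
    (f₁ : Idx m₁ m₂ l₁ → Idx n₁ n₂ k₁) (f₂ : Idx m₁ m₂ l₂ → Idx n₁ n₂ k₂)
    (hX₁ : ∀ ω p, X₁ ω (e₁ p) = Y₁ ω (f₁ p)) (hX₂ : ∀ ω p, X₂ ω (e₂ p) = Y₂ ω (f₂ p))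
    {d' : Fin m₂ → ℝ} (hpos : ∀ i, 0 < d' i) (hlt : ∀ i, d' i < 1) (hanti : Antitone d')
    (hQ : ∀ p q, qCvf n₁ k₁ k₂ d (Sum.map f₁ f₂ p) (Sum.map f₁ f₂ q) = qCvf m₁ l₁ l₂ d' p q) :
    wynerCI X₁ X₂ μ = cvfValue m₁ d' ∧ wynerCIArb X₁ X₂ μ = cvfValue m₁ d' := by
  let S₁ : Vec ι ≃L[ℝ] Vec (Idx m₁ m₂ l₁) :=
    (LinearIsometryEquiv.piLpCongrLeft 2 ℝ ℝ e₁.symm).toContinuousLinearEquiv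
  let S₂ : Vec κ ≃L[ℝ] Vec (Idx m₁ m₂ l₂) :=
    (LinearIsometryEquiv.piLpCongrLeft 2 ℝ ℝ e₂.symm).toContinuousLinearEquiv
  have hcan : IsCanonical d' (fun ω => S₁ (X₁ ω)) (fun ω => S₂ (X₂ ω)) μ := by
    refine ⟨S₁.continuous.measurable.comp h₁, S₂.continuous.measurable.comp h₂, hpos, hlt, hanti,
      hY.law.of_submatrix (Sum.map f₁ f₂) ?_ hQ⟩
    rintro ω (p | p)
    · exact hX₁ ω p
    · exact hX₂ ω p
  have h := wynerCI_comp_equiv (μ := μ) h₁ h₂ S₁ S₂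
  have h' := hcan.exists_wynerCI_eq
  exact ⟨h.1.symm.trans h'.1, h.2.symm.trans h'.2.1⟩

/-- Each part is in canonical variable form, with the two other blocks empty. -/
lemma IsCanonical.wynerCI_part1 (hY : IsCanonical d Y₁ Y₂ μ) :
    wynerCI (fun ω => part1 (Y₁ ω)) (fun ω => part1 (Y₂ ω)) μ =
        cvfValue n₁ (Fin.elim0 : Fin 0 → ℝ) ∧
      wynerCIArb (fun ω => part1 (Y₁ ω)) (fun ω => part1 (Y₂ ω)) μ =
        cvfValue n₁ (Fin.elim0 : Fin 0 → ℝ) := by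
  refine hY.wynerCI_subvector (m₂ := 0) (l₁ := 0) (l₂ := 0)
    (measurable_part1.comp hY.measurable_left) (measurable_part1.comp hY.measurable_right)
    (Equiv.sumEmpty _ _) (Equiv.sumEmpty _ _)
    (Sum.map id (Sum.map Fin.elim0 Fin.elim0)) (Sum.map id (Sum.map Fin.elim0 Fin.elim0))
    ?_ ?_ (fun i => i.elim0) (fun i => i.elim0) (fun i => i.elim0) ?_
  · rintro ω (i | i | i)
    exacts [rfl, i.elim0, i.elim0]
  · rintro ω (i | i | i)
    exacts [rfl, i.elim0, i.elim0]
  · rintro ((i | i | i) | (i | i | i)) ((j | j | j) | (j | j | j))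
    all_goals first
      | exact i.elim0
      | exact j.elim0
      | simp [qCvf, cvfCross, Matrix.one_apply]

lemma IsCanonical.wynerCI_part2 (hY : IsCanonical d Y₁ Y₂ μ) :
    wynerCI (fun ω => part2 (Y₁ ω)) (fun ω => part2 (Y₂ ω)) μ = cvfValue 0 d ∧
      wynerCIArb (fun ω => part2 (Y₁ ω)) (fun ω => part2 (Y₂ ω)) μ = cvfValue 0 d := by
  refine hY.wynerCI_subvector (l₁ := 0) (l₂ := 0)
    (measurable_part2.comp hY.measurable_left) (measurable_part2.comp hY.measurable_right)
    ((Equiv.emptySum _ _).trans (Equiv.sumEmpty _ _))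
    ((Equiv.emptySum _ _).trans (Equiv.sumEmpty _ _))
    (Sum.map Fin.elim0 (Sum.map id Fin.elim0)) (Sum.map Fin.elim0 (Sum.map id Fin.elim0))
    ?_ ?_ hY.pos hY.lt_one hY.antitone ?_
  · rintro ω (i | i | i)
    exacts [i.elim0, rfl, i.elim0]
  · rintro ω (i | i | i)
    exacts [i.elim0, rfl, i.elim0]
  · rintro ((i | i | i) | (i | i | i)) ((j | j | j) | (j | j | j))
    all_goals first
      | exact i.elim0
      | exact j.elim0
      | simp [qCvf, cvfCross, Matrix.one_apply]

lemma IsCanonical.wynerCI_part3 (hY : IsCanonical d Y₁ Y₂ μ) :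
    wynerCI (fun ω => part3 (Y₁ ω)) (fun ω => part3 (Y₂ ω)) μ =
        cvfValue 0 (Fin.elim0 : Fin 0 → ℝ) ∧
      wynerCIArb (fun ω => part3 (Y₁ ω)) (fun ω => part3 (Y₂ ω)) μ =
        cvfValue 0 (Fin.elim0 : Fin 0 → ℝ) := by
  refine hY.wynerCI_subvector
    (measurable_part3.comp hY.measurable_left) (measurable_part3.comp hY.measurable_right)
    ((Equiv.emptySum _ _).trans (Equiv.emptySum _ _))
    ((Equiv.emptySum _ _).trans (Equiv.emptySum _ _))
    (Sum.map Fin.elim0 (Sum.map Fin.elim0 id)) (Sum.map Fin.elim0 (Sum.map Fin.elim0 id))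
    ?_ ?_ (fun i => i.elim0) (fun i => i.elim0) (fun i => i.elim0) ?_
  · rintro ω (i | i | i)
    exacts [i.elim0, i.elim0, rfl]
  · rintro ω (i | i | i)
    exacts [i.elim0, i.elim0, rfl]
  · rintro ((i | i | i) | (i | i | i)) ((j | j | j) | (j | j | j))
    all_goals first
      | exact i.elim0
      | exact j.elim0
      | simp [qCvf, cvfCross, Matrix.one_apply]

lemma sigmaOf_wStar2_le {Ω : Type*} {Y₁ : Ω → Vec (Idx n₁ n₂ k₁)}
    {Y₂ : Ω → Vec (Idx n₁ n₂ k₂)} {V : Ω → Vec (Fin n₂)} :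
    sigmaOf (wStar2 d Y₁ Y₂ V) ≤
      sigmaOf (fun ω => part2 (Y₁ ω)) ⊔ sigmaOf (fun ω => part2 (Y₂ ω)) ⊔ sigmaOf V := by
  set m := sigmaOf (fun ω => part2 (Y₁ ω)) ⊔ sigmaOf (fun ω => part2 (Y₂ ω)) ⊔ sigmaOf V
  have h₁ : Measurable[m] fun ω => part2 (Y₁ ω) :=
    measurable_iff_comap_le.2 (le_sup_left.trans le_sup_left)
  have h₂ : Measurable[m] fun ω => part2 (Y₂ ω) :=
    measurable_iff_comap_le.2 (le_sup_right.trans le_sup_left)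
  have h₃ : Measurable[m] V := measurable_iff_comap_le.2 le_sup_right
  exact Measurable.comap_le ((((measurable_mulV (matL d)).comp h₁).add
    ((measurable_mulV (matL d)).comp h₂)).add ((measurable_mulV (matL3 d)).comp h₃))

end Parts

theorem theorem5 {Ω : Type*} [MeasurableSpace Ω] (μ : Measure Ω) [IsProbabilityMeasure μ]
    {n₁ n₂ k₁ k₂ : ℕ} (d : Fin n₂ → ℝ)
    (Y₁ : Ω → Vec (Idx n₁ n₂ k₁)) (Y₂ : Ω → Vec (Idx n₁ n₂ k₂))
    (hY : IsCanonical d Y₁ Y₂ μ) :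
    -- (a) the value of Wyner's common information, and of its three parts
    (wynerCI Y₁ Y₂ μ =
        wynerCI (fun ω => part1 (Y₁ ω)) (fun ω => part1 (Y₂ ω)) μ
          + wynerCI (fun ω => part2 (Y₁ ω)) (fun ω => part2 (Y₂ ω)) μ
          + wynerCI (fun ω => part3 (Y₁ ω)) (fun ω => part3 (Y₂ ω)) μ
      ∧ (n₁ = 0 → n₂ = 0 → wynerCI Y₁ Y₂ μ = 0)
      ∧ (n₁ = 0 →
          wynerCI Y₁ Y₂ μ = ENNReal.ofReal (1 / 2 * ∑ i, Real.log ((1 + d i) / (1 - d i))))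
      ∧ (0 < n₁ → wynerCI Y₁ Y₂ μ = ⊤)
      ∧ (0 < n₁ → wynerCI (fun ω => part1 (Y₁ ω)) (fun ω => part1 (Y₂ ω)) μ = ⊤)
      ∧ wynerCI (fun ω => part3 (Y₁ ω)) (fun ω => part3 (Y₂ ω)) μ = 0
      ∧ wynerCI (fun ω => part2 (Y₁ ω)) (fun ω => part2 (Y₂ ω)) μ
          = ENNReal.ofReal (1 / 2 * ∑ i, Real.log ((1 + d i) / (1 - d i)))
      -- the same values are obtained if non-Gaussian `W` are admitted in the infimum
      ∧ wynerCIArb Y₁ Y₂ μ = wynerCI Y₁ Y₂ μ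
      ∧ wynerCIArb (fun ω => part1 (Y₁ ω)) (fun ω => part1 (Y₂ ω)) μ
          = wynerCI (fun ω => part1 (Y₁ ω)) (fun ω => part1 (Y₂ ω)) μ
      ∧ wynerCIArb (fun ω => part2 (Y₁ ω)) (fun ω => part2 (Y₂ ω)) μ
          = wynerCI (fun ω => part2 (Y₁ ω)) (fun ω => part2 (Y₂ ω)) μ
      ∧ wynerCIArb (fun ω => part3 (Y₁ ω)) (fun ω => part3 (Y₂ ω)) μ
          = wynerCI (fun ω => part3 (Y₁ ω)) (fun ω => part3 (Y₂ ω)) μ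
      -- the values are those of every tuple whose canonical variable form is `(Y₁, Y₂)`
      ∧ (∀ (p₁ p₂ : ℕ) (X₁ : Ω → Vec (Fin p₁)) (X₂ : Ω → Vec (Fin p₂))
          (S₁ : Vec (Fin p₁) ≃L[ℝ] Vec (Idx n₁ n₂ k₁))
          (S₂ : Vec (Fin p₂) ≃L[ℝ] Vec (Idx n₁ n₂ k₂)),
          (∀ ω, Y₁ ω = S₁ (X₁ ω)) → (∀ ω, Y₂ ω = S₂ (X₂ ω)) →
            wynerCI X₁ X₂ μ = wynerCI Y₁ Y₂ μ ∧ wynerCIArb X₁ X₂ μ = wynerCIArb Y₁ Y₂ μ)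
      -- the infimum is attained, by some `W` of dimension `n₁ + n₂`
      ∧ (∃ Q ∈ cigLaws (μ.map fun ω => (Y₁ ω, Y₂ ω)) (Fin n₁ ⊕ Fin n₂),
          mutualInfo (fun z => z.1) (fun z => z.2) Q = wynerCI Y₁ Y₂ μ)) ∧
    -- (b), (c): for every standard Gaussian vector `V` which is independent of `(Y₁, Y₂)`
    ∀ V : Ω → Vec (Fin n₂), Measurable V → IsG0 V 1 μ →
      IndepFun V (fun ω => (Y₁ ω, Y₂ ω)) μ →
      -- (b) the random variable `W*` attains the infimum
      (wStar1 Y₁ =ᵐ[μ] (fun ω => part1 (Y₂ ω))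
        ∧ IsG0 (fun ω => vcat (vcat (Y₁ ω) (Y₂ ω)) (wStar d Y₁ Y₂ V ω)) (qTriple n₁ k₁ k₂ d) μ
        ∧ IsG0 (fun ω => vcat (vcat (part2 (Y₁ ω)) (part2 (Y₂ ω))) (wStar2 d Y₁ Y₂ V ω))
            (qS d 1) μ
        ∧ IsCIG Y₁ Y₂ (wStar d Y₁ Y₂ V) μ
        ∧ sigmaOf (wStar1 Y₁) ≤
            sigmaOf (fun ω => part1 (Y₁ ω)) ⊔ sigmaOf (fun ω => part1 (Y₂ ω))
        ∧ sigmaOf (wStar2 d Y₁ Y₂ V) ≤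
            sigmaOf (fun ω => part2 (Y₁ ω)) ⊔ sigmaOf (fun ω => part2 (Y₂ ω)) ⊔ sigmaOf V
        ∧ wynerCI Y₁ Y₂ μ = mutualInfo (fun ω => (Y₁ ω, Y₂ ω)) (wStar d Y₁ Y₂ V) μ) ∧
      -- (c) the realization of `(Y₁, Y₂)` in terms of `W*` and of the noises `Z₁`, `Z₂`
      (crossCov (wStar2 d Y₁ Y₂ V) (wStar2 d Y₁ Y₂ V) μ = 1
        ∧ regMatrix (fun ω => part2 (Y₁ ω)) (wStar2 d Y₁ Y₂ V) μ = sqrtD d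
        ∧ regMatrix (fun ω => part2 (Y₂ ω)) (wStar2 d Y₁ Y₂ V) μ = sqrtD d
        ∧ μ[fun ω => part2 (Y₁ ω) | sigmaOf (wStar2 d Y₁ Y₂ V)] =ᵐ[μ]
            (fun ω => mulV (regMatrix (fun ω' => part2 (Y₁ ω')) (wStar2 d Y₁ Y₂ V) μ)
              (wStar2 d Y₁ Y₂ V ω))
        ∧ μ[fun ω => part2 (Y₂ ω) | sigmaOf (wStar2 d Y₁ Y₂ V)] =ᵐ[μ]
            (fun ω => mulV (regMatrix (fun ω' => part2 (Y₂ ω')) (wStar2 d Y₁ Y₂ V) μ)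
              (wStar2 d Y₁ Y₂ V ω))
        ∧ Y₁ =ᵐ[μ] (fun ω =>
            mulV (loadW n₁ k₁ (regMatrix (fun ω' => part2 (Y₁ ω')) (wStar2 d Y₁ Y₂ V) μ))
                (wStar d Y₁ Y₂ V ω)
              + mulV (loadZ n₁ n₂ k₁) (noise Y₁ (wStar2 d Y₁ Y₂ V) μ ω))
        ∧ Y₂ =ᵐ[μ] (fun ω =>
            mulV (loadW n₁ k₂ (regMatrix (fun ω' => part2 (Y₂ ω')) (wStar2 d Y₁ Y₂ V) μ))
                (wStar d Y₁ Y₂ V ω)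
              + mulV (loadZ n₁ n₂ k₂) (noise Y₂ (wStar2 d Y₁ Y₂ V) μ ω))
        ∧ IsG0 (wStar d Y₁ Y₂ V) 1 μ
        ∧ IsG0 (noise Y₁ (wStar2 d Y₁ Y₂ V) μ) (qNoise k₁ d) μ
        ∧ IsG0 (noise Y₂ (wStar2 d Y₁ Y₂ V) μ) (qNoise k₂ d) μ
        ∧ IndepFun (noise Y₁ (wStar2 d Y₁ Y₂ V) μ) (noise Y₂ (wStar2 d Y₁ Y₂ V) μ) μ
        ∧ IndepFun (fun ω => (noise Y₁ (wStar2 d Y₁ Y₂ V) μ ω, noise Y₂ (wStar2 d Y₁ Y₂ V) μ ω))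
            (wStar d Y₁ Y₂ V) μ) := by
  obtain ⟨hC, hA, hatt⟩ := hY.exists_wynerCI_eq
  obtain ⟨hC₁, hA₁⟩ := hY.wynerCI_part1
  obtain ⟨hC₂, hA₂⟩ := hY.wynerCI_part2
  obtain ⟨hC₃, hA₃⟩ := hY.wynerCI_part3
  have h3 : cvfValue 0 (Fin.elim0 : Fin 0 → ℝ) = 0 := by simp [cvfValue]
  refine ⟨⟨?_, ?_, ?_, ?_, ?_, ?_, ?_, ?_, ?_, ?_, ?_, ?_, ?_⟩, fun V hVm hV hVY => ?_⟩
  · rw [hC, hC₁, hC₂, hC₃, h3, add_zero]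
    rcases Nat.eq_zero_or_pos n₁ with rfl | hn
    · rw [h3, zero_add]
    · simp [cvfValue, hn.ne']
  · rintro rfl rfl
    rw [hC]
    simp [cvfValue]
  · intro hn
    rw [hC, cvfValue, if_pos hn]
  · intro hn
    rw [hC, cvfValue, if_neg hn.ne']
  · intro hn
    rw [hC₁, cvfValue, if_neg hn.ne']
  · rw [hC₃, h3]
  · rw [hC₂, cvfValue, if_pos rfl]
  · rw [hC, hA]
  · rw [hC₁, hA₁]
  · rw [hC₂, hA₂]
  · rw [hC₃, hA₃]
  · intro p₁ p₂ X₁ X₂ S₁ S₂ h₁ h₂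
    have e₁ : Y₁ = fun ω => S₁ (X₁ ω) := funext h₁
    have e₂ : Y₂ = fun ω => S₂ (X₂ ω) := funext h₂
    have m₁ : Measurable X₁ := by
      have h := S₁.symm.continuous.measurable.comp hY.measurable_left
      simpa [e₁, Function.comp_def] using h
    have m₂ : Measurable X₂ := by
      have h := S₂.symm.continuous.measurable.comp hY.measurable_right
      simpa [e₂, Function.comp_def] using h
    have h := wynerCI_comp_equiv (μ := μ) m₁ m₂ S₁ S₂
    rw [← e₁, ← e₂] at h
    exact ⟨h.1.symm, h.2.symm⟩
  · rw [hC]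
    exact hatt
  have hr₁ := hY.regMatrix_left hV hVY
  have hr₂ := hY.regMatrix_right hV hVY
  have hc₁ := hY.condExp_part2_left hVm hV hVY
  have hc₂ := hY.condExp_part2_right hVm hV hVY
  have hz₁ := noise_ae_eq_linearNoise hc₁
  have hz₂ := noise_ae_eq_linearNoise hc₂
  refine ⟨⟨?_, hY.isG0_triple hV hVY, hY.isG0_qS hV hVY, hY.isCIG_wStar hVm hV hVY, le_sup_left,
    sigmaOf_wStar2_le, ?_⟩, hY.crossCov_wStar2 hV hVY, hr₁, hr₂, ?_, ?_, ?_, ?_,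
    hY.isG0_wStar hV hVY, (hY.isG0_linearNoise_left hV hVY).congr hz₁,
    (hY.isG0_linearNoise_right hV hVY).congr hz₂,
    (hY.noises_indepFun hV hVY).congr hz₁.symm hz₂.symm,
    (hY.noises_indepFun_wStar hV hVY).congr (hz₁.symm.prodMk hz₂.symm) .rfl⟩
  · filter_upwards [hY.part1_ae_eq] with ω hω
    ext i
    exact hω i
  · rw [hC, hY.mutualInfo_wStar hVm hV hVY]
  · rw [hr₁]
    exact hc₁
  · rw [hr₂]
    exact hc₂
  · filter_upwards [hz₁] with ω hω
    rw [hr₁, hω]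
    exact eq_loadW_add_loadZ fun _ => rfl
  · filter_upwards [hz₂, hY.part1_ae_eq] with ω hω h1
    rw [hr₂, hω]
    exact eq_loadW_add_loadZ fun i => (h1 i).symm
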